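/- Let $m\in\mathbb N$, $a<b$, $\varepsilon_0>0$. For each $\varepsilon\in[0,\varepsilon_0]$ let $A(\cdot;\varepsilon)\in L^1([a,b];\mathbb C^{m\times m})$ and let $U_\varepsilon:C([a,b];\mathbb C^m)\to\mathbb C^m$ be a continuous linear operator. For $f\in L^1([a,b];\mathbb C^m)$ consider the boundary value problem $$y'(t)=A(t;\varepsilon)y(t)+f(t)\ \text{ for a.e. } t\in(a,b),\qquad U_\varepsilon y=0, \tag{$P_\varepsilon$}$$ whose solutions are understood to be absolutely continuous functions $y:[a,b]\to\mathbb C^m$. A *Green matrix* of $(P_\varepsilon)$ is a matrix function $G(\cdot,\cdot;\varepsilon)\in L_\infty([a,b]\times[a,b];\mathbb C^{m\times m})$ such that for every $f\in L^1([a,b];\mathbb C^m)$ the problem $(P_\varepsilon)$ has a unique solution $y$, and $y(t)=\int_a^b G(t,s;\varepsilon)f(s)\,ds$ for every $t\in[a,b]$ (the integral being convergent). Let $|X|=\sum_{i,j}|x_{ij}|$ for $X\in\mathbb C^{m\times m}$, and let $\mathcal M^m$ be the class of families $R(\cdot;\varepsilon)\in L^1([a,b];\mathbb C^{m\times m})$,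 $\varepsilon\in[0,\varepsilon_0]$, for which the (absolutely continuous) matrix solution $Z(\cdot;\varepsilon)$ of the Cauchy problem $Z'=R(\cdot;\varepsilon)Z$, $Z(a;\varepsilon)=I_m$, satisfies $\sup_{t\in[a,b]}|Z(t;\varepsilon)-I_m|\to0$ as $\varepsilon\to+0$. **Theorem 2.** Assume that * the homogeneous limit problem $y'=A(\cdot;0)y$, $U_0y=0$ has only the trivial solution; * $A(\cdot;\varepsilon)-A(\cdot;0)\in\mathcal M^m$; * $\|U_\varepsilon-U_0\|\to0$ as $\varepsilon\to+0$, in the operator norm. Then: 1. There are $\varepsilon_1\in(0,\varepsilon_0]$ and everywhere defined Green matrices $G(\cdot,\cdot;\varepsilon)$ of $(P_\varepsilon)$, $\varepsilon\in[0,\varepsilon_1]$, such that $\sup_{t,s\in[a,b]}|G(t,s;\varepsilon)-G(t,s;0)|\to0$ as $\varepsilon\to+0$, that is, $G(\cdot,\cdot;\varepsilon)\to G(\cdot,\cdot;0)$ uniformly on the square $[a,b]\times[a,b]$. 2. For any choice of Green matrices $G(\cdot,\cdot;0)$ of $(P_0)$ and $G(\cdot,\cdot;\varepsilon)$ of $(P_\varepsilon)$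 for all sufficiently small $\varepsilon>0$, one has $\|G(\cdot,\cdot;\varepsilon)-G(\cdot,\cdot;0)\|_{L_\infty([a,b]\times[a,b])}\to0$ as $\varepsilon\to+0$. -/

import Mathlib

open MeasureTheory Set Filter Topology
open scoped Matrix ENNReal

namespace GreenBVP

variable {m : ℕ}

/-- The norm `|X| = ∑ |x_ij|` of a complex `m × m` matrix. -/
noncomputable def matNorm (X : Matrix (Fin m) (Fin m) ℂ) : ℝ := ∑ i, ∑ j, ‖X i j‖

/-- The matrix function `R` belongs to `L([a, b]; ℂ^{m × m})`: all its entries are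
Lebesgue integrable on `[a, b]`. -/
def MatIntegrable (a b : ℝ) (R : ℝ → Matrix (Fin m) (Fin m) ℂ) : Prop :=
  ∀ i j, IntegrableOn (fun t => R t i j) (Icc a b)

/-- `y` is a solution on `[a, b]` of the system `y' = A y + f`: it is absolutely continuous on
`[a, b]` and the equation holds almost everywhere in `(a, b)`. -/
def SolvesSystem (a b : ℝ) (A : ℝ → Matrix (Fin m) (Fin m) ℂ) (f : ℝ → Fin m → ℂ)
    (y : ℝ → Fin m → ℂ) : Prop :=
  AbsolutelyContinuousOnInterval y a b ∧
    ∀ᵐ t : ℝ, t ∈ Ioo a b → HasDerivAt y (A t *ᵥ y t + f t) t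

/-- `Z` is the matrix solution of the Cauchy problem `Z' = R Z`, `Z(a) = I` on `[a, b]`
(the system is solved by each column). -/
def SolvesMatrixCauchy (a b : ℝ) (R Z : ℝ → Matrix (Fin m) (Fin m) ℂ) : Prop :=
  Z a = 1 ∧ ∀ j, SolvesSystem a b R 0 (fun t i => Z t i j)

/-- The class `𝓜^m` of families `R(·; ε)`, `ε ∈ [0, ε₀]`, of integrable matrix functions on
`[a, b]` such that the matrix solution `Z(·; ε)` of the Cauchy problem `Z' = R(·; ε) Z`, `Z(a) = I`
converges to `I` uniformly on `[a, b]` as `ε → +0`. -/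
def ClassM (a b ε₀ : ℝ) (R : ℝ → ℝ → Matrix (Fin m) (Fin m) ℂ) : Prop :=
  (∀ ε ∈ Icc 0 ε₀, MatIntegrable a b (R ε)) ∧
    ∃ Z : ℝ → ℝ → Matrix (Fin m) (Fin m) ℂ,
      (∀ ε ∈ Icc 0 ε₀, SolvesMatrixCauchy a b (R ε) (Z ε)) ∧
      ∀ δ : ℝ, 0 < δ → ∀ᶠ ε in 𝓝[>] (0 : ℝ), ∀ t ∈ Icc a b, matNorm (Z ε t - 1) < δ

/-- `y` is a solution of the boundary value problem `y' = A y + f` on `(a, b)`, `U y = c`. -/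
def SolvesBVP {a b : ℝ} (hab : a ≤ b) (A : ℝ → Matrix (Fin m) (Fin m) ℂ) (f : ℝ → Fin m → ℂ)
    (U : C(Icc a b, Fin m → ℂ) →L[ℂ] (Fin m → ℂ)) (c : Fin m → ℂ)
    (y : C(Icc a b, Fin m → ℂ)) : Prop :=
  SolvesSystem a b A f (IccExtend hab y) ∧ U y = c

/-- `G` is a Green matrix of the semi-homogeneous problem `y' = A y + f`, `U y = 0`: it is
(measurable and) essentially bounded on the square `[a, b] × [a, b]`, and for every integrable `f`
the problem has exactly one solution `y`, which is given by `y(t) = ∫_a^b G(t, s) f(s) ds` for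
every `t ∈ [a, b]`. -/
structure IsGreenMatrix {a b : ℝ} (hab : a ≤ b) (A : ℝ → Matrix (Fin m) (Fin m) ℂ)
    (U : C(Icc a b, Fin m → ℂ) →L[ℂ] (Fin m → ℂ))
    (G : ℝ → ℝ → Matrix (Fin m) (Fin m) ℂ) : Prop where
  memLp_top : ∀ i j, MemLp (fun p : ℝ × ℝ => G p.1 p.2 i j) ∞
    (volume.restrict (Icc a b ×ˢ Icc a b))
  representation : ∀ f : ℝ → Fin m → ℂ, IntegrableOn f (Icc a b) →
    ∃ y : C(Icc a b, Fin m → ℂ), SolvesBVP hab A f U 0 y ∧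
      (∀ y' : C(Icc a b, Fin m → ℂ), SolvesBVP hab A f U 0 y' → y' = y) ∧
      ∀ t : Icc a b, IntegrableOn (fun s => G t s *ᵥ f s) (Icc a b) ∧
        y t = ∫ s in a..b, G t s *ᵥ f s

end GreenBVP

/-!
The problem is treated in a coordinate-free way, for a finite-dimensional complex space `E` and
operator-valued coefficients, and equations are understood as integral equations; by the fundamental
theorem of calculus for absolutely continuous functions (`isPrimitiveOn_of_ae_hasDerivAt`) this is
the same as solving the system almost everywhere.

**The Green kernel.** Let `Y` be the fundamental solution of `Y' = A Y`, `Y(a) = 1`. It exists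
because Volterra operators are quasi-nilpotent (`isUnit_one_sub_volterra`), and it is invertible in
the Banach algebra `C([a, b]; End E)` (`isUnit_fundamental`). The solutions of `y' = A y + f` are
`y = Y (c + w)`, `w(t) = ∫_a^t Y⁻¹ f`, and the boundary condition reads `M c + T w = 0`, where
`T φ = U(Y φ)` and `M c = U(Y c)`. The functional `T` acts on primitives `w` of integrable functions
through a bounded density, `T w = ∫_a^b h w'` (`exists_density`). Hence, if `M` is invertible,
`G(t, s) = Y(t) (1_{s ≤ t} - M⁻¹ h(s)) Y(s)⁻¹` is a Green kernel (`isGreenKernel_greenKernel`).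

**Convergence.** Let `Z` be the fundamental solution for `R = A(ε) - A(0)`. The substitution
`Y = Z W` turns `Y' = A(ε) Y` into `W' = (Z⁻¹ A(0) Z) W`, and `Z → 1` uniformly makes the new
coefficient converge to `A(0)` in `L¹`; so the fundamental solutions converge uniformly
(`tendsto_fundamental`), and with them their inverses, the functionals `T` and the operators `M`.
The densities are chosen as `h(ε) = h(0) + k(ε)`, where `k(ε)` is a density of `T(ε) - T(0)` bounded
by its norm. Therefore the kernels above converge uniformly everywhere on the square
(`exists_greenKernel_tendsto`).

**Arbitrary Green matrices.** The Green matrix is unique almost everywhere on the square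
(`IsGreenMatrix.ae_eq`), so the convergence in `L^∞` for any choice follows from that for the
constructed kernels.
-/

namespace GreenBVP

/-! ### Primitives of integrable functions -/

section Primitives

variable {F G H : Type*} [NormedAddCommGroup F] [NormedSpace ℝ F] [NormedAddCommGroup G]
  [NormedSpace ℝ G] [NormedAddCommGroup H] [NormedSpace ℝ H] {a b : ℝ}

theorem absolutelyContinuousOnInterval_integral {g : ℝ → F}
    (hg : IntervalIntegrable g volume a b) :
    AbsolutelyContinuousOnInterval (fun x => ∫ s in a..x, g s) a b := by
  have hN := hg.norm.absolutelyContinuousOnInterval_intervalIntegral (c := a) left_mem_uIcc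
  unfold AbsolutelyContinuousOnInterval at hN ⊢
  refine squeeze_zero' (Eventually.of_forall fun E => Finset.sum_nonneg fun i _ => dist_nonneg) ?_
    hN
  filter_upwards [mem_inf_of_right (mem_principal_self _)] with E hE
  refine Finset.sum_le_sum fun i hi => ?_
  obtain ⟨h1, h2⟩ := hE.1 i hi
  have key : ∀ x ∈ uIcc a b, IntervalIntegrable g volume a x := fun x hx =>
    hg.mono_set (uIcc_subset_uIcc left_mem_uIcc hx)
  rw [dist_comm, dist_comm (∫ s in a..(E.2 i).1, ‖g s‖), dist_eq_norm, Real.dist_eq,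
    intervalIntegral.integral_interval_sub_left (key _ h2) (key _ h1),
    intervalIntegral.integral_interval_sub_left (key _ h2).norm (key _ h1).norm]
  exact intervalIntegral.norm_integral_le_abs_integral_norm

/-- Absolute continuity is stable under continuous bilinear products. -/
theorem _root_.AbsolutelyContinuousOnInterval.bilin (B : F →L[ℝ] G →L[ℝ] H) {u : ℝ → F} {v : ℝ → G}
    (hu : AbsolutelyContinuousOnInterval u a b) (hv : AbsolutelyContinuousOnInterval v a b) :
    AbsolutelyContinuousOnInterval (fun t => B (u t) (v t)) a b := by
  obtain ⟨C, hC⟩ := hu.exists_bound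
  obtain ⟨D, hD⟩ := hv.exists_bound
  have hlim : Tendsto (fun E : ℕ × (ℕ → ℝ × ℝ) =>
      (‖B‖ * C) * ∑ i ∈ Finset.range E.1, dist (v (E.2 i).1) (v (E.2 i).2) +
      (‖B‖ * D) * ∑ i ∈ Finset.range E.1, dist (u (E.2 i).1) (u (E.2 i).2))
      (AbsolutelyContinuousOnInterval.totalLengthFilter ⊓
        𝓟 (AbsolutelyContinuousOnInterval.disjWithin a b)) (𝓝 0) := by
    simpa using (Tendsto.const_mul (‖B‖ * C) hv).add (Tendsto.const_mul (‖B‖ * D) hu)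
  unfold AbsolutelyContinuousOnInterval
  refine squeeze_zero' (Eventually.of_forall fun E => Finset.sum_nonneg fun i _ => dist_nonneg) ?_
    hlim
  filter_upwards [mem_inf_of_right (mem_principal_self _)] with E hE
  rw [Finset.mul_sum, Finset.mul_sum, ← Finset.sum_add_distrib]
  refine Finset.sum_le_sum fun i hi => ?_
  obtain ⟨h1, h2⟩ := hE.1 i hi
  set x := (E.2 i).1
  set y := (E.2 i).2
  rw [dist_eq_norm, dist_eq_norm, dist_eq_norm]
  have e : B (u x) (v x) - B (u y) (v y) = B (u x) (v x - v y) + B (u x - u y) (v y) := by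
    simp
  rw [e]
  calc _ ≤ ‖B (u x) (v x - v y)‖ + ‖B (u x - u y) (v y)‖ := norm_add_le _ _
    _ ≤ ‖B‖ * ‖u x‖ * ‖v x - v y‖ + ‖B‖ * ‖u x - u y‖ * ‖v y‖ :=
      add_le_add (B.le_opNorm₂ _ _) (B.le_opNorm₂ _ _)
    _ ≤ ‖B‖ * C * ‖v x - v y‖ + ‖B‖ * ‖u x - u y‖ * D := by
      gcongr
      · exact hC _ h1
      · exact hD _ h2
    _ = _ := by ring

theorem _root_.AbsolutelyContinuousOnInterval.clm_comp (L : F →L[ℝ] G) {u : ℝ → F}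
    (hu : AbsolutelyContinuousOnInterval u a b) :
    AbsolutelyContinuousOnInterval (fun t => L (u t)) a b :=
  ((LipschitzWith.const L).lipschitzOnWith.absolutelyContinuousOnInterval).bilin
    (ContinuousLinearMap.id ℝ (F →L[ℝ] G)) hu

/-- On `[a, b]` the function `y` is a primitive of the integrable function `g`: the integrated form
of `y' = g` almost everywhere with `y` absolutely continuous. -/
structure IsPrimitiveOn (a b : ℝ) (y g : ℝ → F) : Prop where
  intervalIntegrable : IntervalIntegrable g volume a b
  eq_add_integral : ∀ t ∈ Icc a b, y t = y a + ∫ s in a..t, g s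

theorem ae_mem_uIcc_of_mem_Ioo (hab : a ≤ b) {p : ℝ → Prop}
    (h : ∀ᵐ t : ℝ, t ∈ Ioo a b → p t) : ∀ᵐ t : ℝ, t ∈ uIcc a b → p t := by
  filter_upwards [h, Measure.ae_ne volume a, Measure.ae_ne volume b] with t ht h1 h2 hm
  rw [uIcc_of_le hab] at hm
  exact ht ⟨lt_of_le_of_ne hm.1 (Ne.symm h1), lt_of_le_of_ne hm.2 h2⟩

/-- The fundamental theorem of calculus for absolutely continuous functions with values in a Banach
space, the derivative being given. -/
theorem isPrimitiveOn_of_ae_hasDerivAt [CompleteSpace F] (hab : a ≤ b) {y g : ℝ → F}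
    (hy : AbsolutelyContinuousOnInterval y a b) (hg : IntervalIntegrable g volume a b)
    (h : ∀ᵐ t : ℝ, t ∈ Ioo a b → HasDerivAt y (g t) t) : IsPrimitiveOn a b y g := by
  refine ⟨hg, fun t ht => ?_⟩
  have hd : ∀ᵐ t : ℝ, t ∈ uIcc a b → HasDerivAt (fun x => y x - ∫ s in a..x, g s) 0 t := by
    filter_upwards [ae_mem_uIcc_of_mem_Ioo hab h, hg.ae_hasDerivAt_integral] with t h1 h2 hm
    simpa using! (h1 hm).sub (h2 hm a left_mem_uIcc)
  obtain ⟨C, hC⟩ :=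
    (hy.fun_sub (absolutelyContinuousOnInterval_integral hg)).const_of_ae_hasDerivAt_zero hd
  have e1 := hC a left_mem_uIcc
  have e2 := hC t (by rwa [uIcc_of_le hab])
  simp only [intervalIntegral.integral_same, sub_zero] at e1
  rw [e1, ← e2]
  abel

namespace IsPrimitiveOn

theorem congr {y g y' g' : ℝ → F} (h : IsPrimitiveOn a b y g) (hab : a ≤ b)
    (hy : ∀ t ∈ Icc a b, y t = y' t) (hg : ∀ t ∈ Icc a b, g t = g' t) :
    IsPrimitiveOn a b y' g' := by
  refine ⟨h.1.congr fun t ht => hg t (uIoc_subset_uIcc.trans (uIcc_of_le hab).subset ht),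
    fun t ht => ?_⟩
  rw [← hy t ht, ← hy a (left_mem_Icc.2 hab), h.2 t ht]
  congr 1
  refine intervalIntegral.integral_congr fun s hs => hg s ?_
  rw [uIcc_of_le ht.1] at hs
  exact ⟨hs.1, hs.2.trans ht.2⟩

theorem absolutelyContinuousOnInterval {y g : ℝ → F} (h : IsPrimitiveOn a b y g) (hab : a ≤ b) :
    AbsolutelyContinuousOnInterval y a b := by
  have h1 := absolutelyContinuousOnInterval_integral h.1
  rw [absolutelyContinuousOnInterval_iff] at h1 ⊢
  intro ε hε
  obtain ⟨δ, hδ, h2⟩ := h1 ε hε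
  refine ⟨δ, hδ, fun E hE hs => lt_of_eq_of_lt (Finset.sum_congr rfl fun i hi => ?_) (h2 E hE hs)⟩
  obtain ⟨m1, m2⟩ := hE.1 i hi
  rw [uIcc_of_le hab] at m1 m2
  rw [h.2 _ m1, h.2 _ m2, dist_add_left]

theorem ae_hasDerivAt [CompleteSpace F] {y g : ℝ → F} (h : IsPrimitiveOn a b y g) :
    ∀ᵐ t : ℝ, t ∈ Ioo a b → HasDerivAt y (g t) t := by
  filter_upwards [h.1.ae_hasDerivAt_integral] with t ht hm
  have hab := (hm.1.trans hm.2).le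
  have := (ht (uIcc_of_le hab ▸ Ioo_subset_Icc_self hm) a left_mem_uIcc).const_add (y a)
  refine this.congr_of_eventuallyEq ?_
  filter_upwards [Ioo_mem_nhds hm.1 hm.2] with x hx
  exact h.2 x (Ioo_subset_Icc_self hx)

theorem continuousOn {y g : ℝ → F} (h : IsPrimitiveOn a b y g) (hab : a ≤ b) :
    ContinuousOn y (Icc a b) := by
  simpa [uIcc_of_le hab] using (h.absolutelyContinuousOnInterval hab).continuousOn

/-- The product rule for primitives of integrable functions. -/
theorem bilin [CompleteSpace F] [CompleteSpace G] [CompleteSpace H] (hab : a ≤ b)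
    (B : F →L[ℝ] G →L[ℝ] H) {u u' : ℝ → F} {v v' : ℝ → G}
    (hu : IsPrimitiveOn a b u u') (hv : IsPrimitiveOn a b v v') :
    IsPrimitiveOn a b (fun t => B (u t) (v t)) (fun t => B (u t) (v' t) + B (u' t) (v t)) := by
  refine isPrimitiveOn_of_ae_hasDerivAt hab ((hu.absolutelyContinuousOnInterval hab).bilin B
    (hv.absolutelyContinuousOnInterval hab)) (IntervalIntegrable.add ?_ ?_) ?_
  · have hc := hu.continuousOn hab
    have h1 := hv.1
    rw [intervalIntegrable_iff_integrableOn_Icc_of_le hab] at h1 ⊢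
    obtain ⟨C, hC⟩ := isCompact_Icc.exists_bound_of_continuousOn hc
    refine (h1.norm.const_mul (‖B‖ * C)).mono'
      (B.aestronglyMeasurable_comp₂ (hc.aestronglyMeasurable measurableSet_Icc)
        h1.aestronglyMeasurable) ?_
    filter_upwards [ae_restrict_mem measurableSet_Icc] with t ht
    refine (B.le_opNorm₂ _ _).trans ?_
    gcongr
    exact hC t ht
  · have hc := hv.continuousOn hab
    have h1 := hu.1
    rw [intervalIntegrable_iff_integrableOn_Icc_of_le hab] at h1 ⊢
    obtain ⟨C, hC⟩ := isCompact_Icc.exists_bound_of_continuousOn hc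
    refine (h1.norm.const_mul (‖B‖ * C)).mono'
      (B.aestronglyMeasurable_comp₂ h1.aestronglyMeasurable
        (hc.aestronglyMeasurable measurableSet_Icc)) ?_
    filter_upwards [ae_restrict_mem measurableSet_Icc] with t ht
    refine (B.le_opNorm₂ _ _).trans ?_
    rw [mul_right_comm]
    gcongr
    exact hC t ht
  · filter_upwards [hu.ae_hasDerivAt, hv.ae_hasDerivAt] with t h1 h2 hm
    exact B.hasDerivAt_of_bilinear (fun _ => h1 hm) (fun _ => h2 hm)

end IsPrimitiveOn

end Primitives

/-! ### Volterra equations -/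

section Extension

variable {F : Type*} [NormedAddCommGroup F] {a b : ℝ}

theorem norm_IccExtend_le (hab : a ≤ b) (y : C(Icc a b, F)) (s : ℝ) :
    ‖IccExtend hab y s‖ ≤ ‖y‖ := y.norm_coe_le_norm _

theorem continuous_IccExtend (hab : a ≤ b) (y : C(Icc a b, F)) : Continuous (IccExtend hab y) :=
  y.continuous.Icc_extend'

theorem intervalIntegrable_of_mem_Icc {g : ℝ → F} (hg : IntervalIntegrable g volume a b)
    (t : Icc a b) : IntervalIntegrable g volume a t :=
  hg.mono_set (uIcc_subset_uIcc left_mem_uIcc (Icc_subset_uIcc t.2))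

end Extension

section Operators

variable {V : Type*} [NormedAddCommGroup V] [NormedSpace ℂ V] [CompleteSpace V]

theorem isUnit_one_sub_of_norm_pow_lt_one {n : ℕ} {T : V →L[ℂ] V} (h : ‖T ^ n‖ < 1) :
    IsUnit (1 - T) := by
  have hu : IsUnit (1 - T ^ n) := isUnit_one_sub_of_norm_lt_one h
  rw [← mul_neg_geom_sum] at hu
  refine ((Commute.isUnit_mul_iff ?_).1 hu).1
  exact Commute.sum_right _ _ _ fun i _ =>
    (Commute.one_left _).sub_left ((Commute.refl _).pow_right i)

theorem tendsto_inverse_apply {ι : Type*} {l : Filter ι} {T : ι → V →L[ℂ] V} {T₀ : V →L[ℂ] V}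
    (h₀ : IsUnit T₀) (h : Tendsto (fun i => ‖T i - T₀‖) l (𝓝 0)) (v : V) :
    Tendsto (fun i => Ring.inverse (T i) v) l (𝓝 (Ring.inverse T₀ v)) := by
  obtain ⟨u, rfl⟩ := h₀
  exact ((ContinuousLinearMap.apply ℂ _ v).continuous.tendsto _).comp
    ((NormedRing.inverse_continuousAt u).tendsto.comp (tendsto_iff_norm_sub_tendsto_zero.2 h))

end Operators

section Volterra

variable {F : Type*} [NormedAddCommGroup F] [NormedSpace ℂ F] {a b : ℝ}

/-- The continuous function `t ↦ ∫_a^t g` on `[a, b]`. -/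
noncomputable def primitive {g : ℝ → F} (hab : a ≤ b) (hg : IntervalIntegrable g volume a b) :
    C(Icc a b, F) where
  toFun t := ∫ s in a..t, g s
  continuous_toFun := by
    have := intervalIntegral.continuousOn_primitive_interval'
      (f := g) (μ := volume) hg (left_mem_uIcc)
    rw [uIcc_of_le hab] at this
    exact this.domRestrict

@[simp]
theorem primitive_apply {g : ℝ → F} (hab : a ≤ b) (hg : IntervalIntegrable g volume a b)
    (t : Icc a b) : primitive hab hg t = ∫ s in a..t, g s := rfl

theorem intervalIntegrable_clm_apply (hab : a ≤ b) {B : ℝ → F →L[ℂ] F}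
    (hB : IntervalIntegrable B volume a b) (y : C(Icc a b, F)) :
    IntervalIntegrable (fun s => B s (IccExtend hab y s)) volume a b := by
  rw [intervalIntegrable_iff_integrableOn_Icc_of_le hab] at hB ⊢
  refine (hB.norm.mul_const ‖y‖).mono'
    ((ContinuousLinearMap.id ℂ (F →L[ℂ] F)).aestronglyMeasurable_comp₂ hB.aestronglyMeasurable
      (continuous_IccExtend hab y).aestronglyMeasurable) ?_
  filter_upwards with s
  exact (B s).le_opNorm_of_le (norm_IccExtend_le hab y s)

theorem norm_integral_clm_apply_le (hab : a ≤ b) {B : ℝ → F →L[ℂ] F}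
    (hB : IntervalIntegrable B volume a b) (y : C(Icc a b, F)) (t : Icc a b) :
    ‖∫ s in a..t, B s (IccExtend hab y s)‖ ≤ (∫ s in a..b, ‖B s‖) * ‖y‖ := by
  have hB' := hB.norm
  calc _ ≤ ∫ s in a..t, ‖B s‖ * ‖y‖ :=
        intervalIntegral.norm_integral_le_of_norm_le t.2.1
          (.of_forall fun s _ => (B s).le_opNorm_of_le (norm_IccExtend_le hab y s))
          ((intervalIntegrable_of_mem_Icc hB' t).mul_const _)
    _ = (∫ s in a..t, ‖B s‖) * ‖y‖ := intervalIntegral.integral_mul_const _ _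
    _ ≤ _ := by
      gcongr
      exact intervalIntegral.integral_mono_interval le_rfl t.2.1 t.2.2
        (.of_forall fun s => norm_nonneg _) hB'

/-- The Volterra operator `(V y)(t) = ∫_a^t B(s) y(s) ds` on `C([a, b]; F)`. -/
noncomputable def volterra (hab : a ≤ b) {B : ℝ → F →L[ℂ] F}
    (hB : IntervalIntegrable B volume a b) : C(Icc a b, F) →L[ℂ] C(Icc a b, F) :=
  LinearMap.mkContinuous
    { toFun := fun y => primitive hab (intervalIntegrable_clm_apply hab hB y)
      map_add' := fun y z => by
        ext t
        simp only [primitive_apply, ContinuousMap.add_apply]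
        rw [← intervalIntegral.integral_add
          (intervalIntegrable_of_mem_Icc (intervalIntegrable_clm_apply hab hB y) t)
          (intervalIntegrable_of_mem_Icc (intervalIntegrable_clm_apply hab hB z) t)]
        simp [IccExtend]
      map_smul' := fun c y => by
        ext t
        simp [IccExtend] }
    (∫ s in a..b, ‖B s‖)
    fun y => (ContinuousMap.norm_le _ (mul_nonneg (intervalIntegral.integral_nonneg hab
      fun _ _ => norm_nonneg _) (norm_nonneg y))).2 (norm_integral_clm_apply_le hab hB y)

theorem volterra_apply (hab : a ≤ b) {B : ℝ → F →L[ℂ] F}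
    (hB : IntervalIntegrable B volume a b) (y : C(Icc a b, F)) (t : Icc a b) :
    volterra hab hB y t = ∫ s in a..t, B s (IccExtend hab y s) := rfl

theorem norm_volterra_sub_le (hab : a ≤ b) {B B' : ℝ → F →L[ℂ] F}
    (hB : IntervalIntegrable B volume a b) (hB' : IntervalIntegrable B' volume a b) :
    ‖volterra hab hB - volterra hab hB'‖ ≤ ∫ s in a..b, ‖B s - B' s‖ := by
  have h0 : 0 ≤ ∫ s in a..b, ‖B s - B' s‖ :=
    intervalIntegral.integral_nonneg hab fun _ _ => norm_nonneg _
  refine ContinuousLinearMap.opNorm_le_bound _ h0 fun y =>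
    (ContinuousMap.norm_le _ (mul_nonneg h0 (norm_nonneg y))).2 fun t => ?_
  refine le_trans (le_of_eq ?_) (norm_integral_clm_apply_le hab (hB.sub hB') y t)
  simp only [_root_.sub_apply, ContinuousMap.sub_apply, volterra_apply]
  rw [← intervalIntegral.integral_sub
    (intervalIntegrable_of_mem_Icc (intervalIntegrable_clm_apply hab hB y) t)
    (intervalIntegrable_of_mem_Icc (intervalIntegrable_clm_apply hab hB' y) t)]

theorem isPrimitiveOn_pow (hab : a ≤ b) {β : ℝ → ℝ} (hβ : IntervalIntegrable β volume a b)
    (n : ℕ) : IsPrimitiveOn a b (fun t => (∫ s in a..t, β s) ^ (n + 1))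
      (fun t => (n + 1) * (β t * (∫ s in a..t, β s) ^ n)) := by
  have h1 : IsPrimitiveOn a b (fun t => ∫ s in a..t, β s) β := ⟨hβ, fun t _ => by simp⟩
  induction n with
  | zero => simpa using h1
  | succ n ih =>
    refine (IsPrimitiveOn.bilin hab (ContinuousLinearMap.mul ℝ ℝ) ih h1).congr hab
      (fun t _ => ?_) fun t _ => ?_
    · simp [pow_succ]
    · simp
      ring

/-- The `n`-th power of a Volterra operator gains the factor `(∫_a^t ‖B‖)ⁿ / n!`. -/
theorem norm_volterra_pow_apply_le (hab : a ≤ b) {B : ℝ → F →L[ℂ] F}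
    (hB : IntervalIntegrable B volume a b) (n : ℕ) (y : C(Icc a b, F)) (t : Icc a b) :
    ‖(volterra hab hB ^ n) y t‖ ≤ (∫ s in a..t, ‖B s‖) ^ n / n.factorial * ‖y‖ := by
  induction n generalizing t with
  | zero => simpa using y.norm_coe_le_norm t
  | succ n ih =>
    have hp := isPrimitiveOn_pow hab hB.norm n
    have hc : ((n : ℝ) + 1) ≠ 0 := by positivity
    have hf : (n.factorial : ℝ) ≠ 0 := by positivity
    rw [pow_succ', mul_apply_eq_comp, volterra_apply]
    set α : ℝ → ℝ := fun t => ∫ s in a..t, ‖B s‖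
    calc _ ≤ ∫ s in a..t, ((n + 1) * (‖B s‖ * α s ^ n)) *
          (((n + 1).factorial : ℝ)⁻¹ * ‖y‖) := by
          refine intervalIntegral.norm_integral_le_of_norm_le t.2.1 (.of_forall fun s hs => ?_)
            ((intervalIntegrable_of_mem_Icc hp.1 t).mul_const _)
          have hs' : s ∈ Icc a b := ⟨hs.1.le, hs.2.trans t.2.2⟩
          rw [IccExtend_of_mem hab _ hs']
          refine ((B s).le_opNorm_of_le (ih ⟨s, hs'⟩)).trans (le_of_eq ?_)
          rw [Nat.factorial_succ]
          push_cast
          simp only [α]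
          field_simp
      _ = (∫ s in a..t, (n + 1) * (‖B s‖ * α s ^ n)) * (((n + 1).factorial : ℝ)⁻¹ * ‖y‖) :=
          intervalIntegral.integral_mul_const _ _
      _ = α t ^ (n + 1) * (((n + 1).factorial : ℝ)⁻¹ * ‖y‖) := by
          have := hp.2 t t.2
          simp only [intervalIntegral.integral_same, ne_eq, Nat.add_eq_zero_iff, one_ne_zero,
            and_false, not_false_eq_true, zero_pow, zero_add] at this
          rw [← this]
      _ = _ := by rw [div_eq_mul_inv, mul_assoc]

/-- Volterra operators are quasi-nilpotent, so that the integral equation `y - V y = g` is uniquely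
solvable. -/
theorem isUnit_one_sub_volterra [CompleteSpace F] (hab : a ≤ b) {B : ℝ → F →L[ℂ] F}
    (hB : IntervalIntegrable B volume a b) : IsUnit (1 - volterra hab hB) := by
  obtain ⟨n, hn⟩ := ((FloorSemiring.tendsto_pow_div_factorial_atTop
    (∫ s in a..b, ‖B s‖)).eventually_lt_const zero_lt_one).exists
  have h0 : 0 ≤ ∫ s in a..b, ‖B s‖ :=
    intervalIntegral.integral_nonneg hab fun _ _ => norm_nonneg _
  have hV : ‖volterra hab hB ^ n‖ < 1 := by
    refine lt_of_le_of_lt (ContinuousLinearMap.opNorm_le_bound _ (by positivity) fun y =>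
      (ContinuousMap.norm_le _ (by positivity)).2 fun t => ?_) hn
    refine (norm_volterra_pow_apply_le hab hB n y t).trans ?_
    gcongr
    · exact intervalIntegral.integral_nonneg t.2.1 fun _ _ => norm_nonneg _
    · exact intervalIntegral.integral_mono_interval le_rfl t.2.1 t.2.2
        (.of_forall fun s => norm_nonneg _) hB.norm
  exact isUnit_one_sub_of_norm_pow_lt_one hV

/-- Uniqueness for the Cauchy problem `y' = B y + f`. -/
theorem eq_of_isPrimitiveOn [CompleteSpace F] (hab : a ≤ b) {B : ℝ → F →L[ℂ] F}
    (hB : IntervalIntegrable B volume a b) {f : ℝ → F} {y z : C(Icc a b, F)}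
    (hy : IsPrimitiveOn a b (IccExtend hab y) fun s => B s (IccExtend hab y s) + f s)
    (hz : IsPrimitiveOn a b (IccExtend hab z) fun s => B s (IccExtend hab z s) + f s)
    (h : IccExtend hab y a = IccExtend hab z a) : y = z := by
  obtain ⟨u, hu⟩ := isUnit_one_sub_volterra hab hB
  have key : (1 - volterra hab hB) (y - z) = 0 := by
    ext t
    have e1 := hy.2 t t.2
    have e2 := hz.2 t t.2
    rw [IccExtend_val] at e1 e2
    simp only [_root_.sub_apply, one_apply_eq_self, map_sub,
      ContinuousMap.sub_apply, volterra_apply, ContinuousMap.zero_apply]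
    rw [e1, e2, h]
    have e3 := intervalIntegral.integral_sub (intervalIntegrable_of_mem_Icc hy.1 t)
      (intervalIntegrable_of_mem_Icc hz.1 t)
    have e4 := intervalIntegral.integral_sub
      (intervalIntegrable_of_mem_Icc (intervalIntegrable_clm_apply hab hB y) t)
      (intervalIntegrable_of_mem_Icc (intervalIntegrable_clm_apply hab hB z) t)
    simp only [add_sub_add_right_eq_sub] at e3
    rw [e3] at e4
    rw [← sub_eq_zero] at e4
    rw [← e4]
    abel
  rw [← hu] at key
  have := congrArg (↑u⁻¹ : C(Icc a b, F) →L[ℂ] C(Icc a b, F)) key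
  rw [← mul_apply_eq_comp, Units.inv_mul, map_zero] at this
  exact sub_eq_zero.1 this

/-- The solution of `y' = B y`, `y(a) = c`, as a function on `[a, b]`. -/
noncomputable def linearSolution (hab : a ≤ b) {B : ℝ → F →L[ℂ] F}
    (hB : IntervalIntegrable B volume a b) (c : F) : C(Icc a b, F) :=
  Ring.inverse (1 - volterra hab hB) (ContinuousMap.const _ c)

theorem linearSolution_apply [CompleteSpace F] (hab : a ≤ b) {B : ℝ → F →L[ℂ] F}
    (hB : IntervalIntegrable B volume a b) (c : F) (t : Icc a b) :
    linearSolution hab hB c t =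
      c + ∫ s in a..t, B s (IccExtend hab (linearSolution hab hB c) s) := by
  have h := congrArg (fun y : C(Icc a b, F) => y t) <| congrArg
    (fun T : C(Icc a b, F) →L[ℂ] C(Icc a b, F) => T (ContinuousMap.const _ c))
    (Ring.mul_inverse_cancel _ (isUnit_one_sub_volterra hab hB))
  simp only [mul_apply_eq_comp, one_apply_eq_self,
    _root_.sub_apply, ContinuousMap.sub_apply, ContinuousMap.const_apply] at h
  rw [sub_eq_iff_eq_add] at h
  exact h

theorem linearSolution_left [CompleteSpace F] (hab : a ≤ b) {B : ℝ → F →L[ℂ] F}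
    (hB : IntervalIntegrable B volume a b) (c : F) :
    IccExtend hab (linearSolution hab hB c) a = c := by
  rw [IccExtend_of_mem hab _ (left_mem_Icc.2 hab), linearSolution_apply]
  simp

theorem isPrimitiveOn_linearSolution [CompleteSpace F] (hab : a ≤ b) {B : ℝ → F →L[ℂ] F}
    (hB : IntervalIntegrable B volume a b) (c : F) :
    IsPrimitiveOn a b (IccExtend hab (linearSolution hab hB c))
      (fun s => B s (IccExtend hab (linearSolution hab hB c) s)) := by
  refine ⟨intervalIntegrable_clm_apply hab hB _, fun t ht => ?_⟩
  rw [linearSolution_left, IccExtend_of_mem hab _ ht, linearSolution_apply]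

/-- Continuous dependence of the solution on the coefficient, with respect to the `L¹` norm. -/
theorem tendsto_linearSolution [CompleteSpace F] {ι : Type*} {l : Filter ι} (hab : a ≤ b)
    {B : ι → ℝ → F →L[ℂ] F} (hB : ∀ i, IntervalIntegrable (B i) volume a b)
    {B₀ : ℝ → F →L[ℂ] F} (hB₀ : IntervalIntegrable B₀ volume a b)
    (h : Tendsto (fun i => ∫ s in a..b, ‖B i s - B₀ s‖) l (𝓝 0)) (c : F) :
    Tendsto (fun i => linearSolution hab (hB i) c) l (𝓝 (linearSolution hab hB₀ c)) := by
  exact tendsto_inverse_apply (isUnit_one_sub_volterra hab hB₀)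
    (squeeze_zero (fun _ => norm_nonneg _)
      (fun i => by
        rw [sub_sub_sub_cancel_left, norm_sub_rev]
        exact norm_volterra_sub_le hab (hB i) hB₀) h) _

end Volterra

/-! ### Densities of functionals on continuous functions -/

section Representation

variable {E E' : Type*} [NormedAddCommGroup E] [NormedSpace ℂ E]
  [NormedAddCommGroup E'] [NormedSpace ℂ E'] {a b : ℝ}

/-- The function `y` stopped at the time `x`, that is, `t ↦ y(min(t, x))` on `[a, b]`; here `y` is
extended by constants outside `[a, b]`. -/
noncomputable def stopped (hab : a ≤ b) (x : ℝ) : C(Icc a b, E) →ₗ[ℂ] C(Icc a b, E) where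
  toFun y := ⟨fun t => IccExtend hab y (min t x), (continuous_IccExtend hab y).comp (by fun_prop)⟩
  map_add' _ _ := rfl
  map_smul' _ _ := rfl

theorem stopped_apply (hab : a ≤ b) (x : ℝ) (y : C(Icc a b, E)) (t : Icc a b) :
    stopped hab x y t = IccExtend hab y (min t x) := rfl

theorem stopped_right (hab : a ≤ b) (y : C(Icc a b, E)) : stopped hab b y = y := by
  ext t
  rw [stopped_apply, min_eq_left t.2.2, IccExtend_val]

theorem stopped_left (hab : a ≤ b) (y : C(Icc a b, E)) :
    stopped hab a y = ContinuousMap.const _ (IccExtend hab y a) := by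
  ext t
  rw [stopped_apply, min_eq_right t.2.1, ContinuousMap.const_apply]

/-- A nearby stopping time changes the stopped function by at most the oscillation of the function
between the two times. -/
theorem norm_stopped_sub_le (hab : a ≤ b) {y : C(Icc a b, E)} {x z C : ℝ}
    (h : ∀ v ∈ uIcc x z, ∀ w ∈ uIcc x z, ‖IccExtend hab y v - IccExtend hab y w‖ ≤ C) :
    ‖stopped hab x y - stopped hab z y‖ ≤ C := by
  have hC : 0 ≤ C := (norm_nonneg _).trans (h x left_mem_uIcc x left_mem_uIcc)
  refine (ContinuousMap.norm_le _ hC).2 fun t => ?_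
  rw [ContinuousMap.sub_apply, stopped_apply, stopped_apply]
  by_cases ht : (t : ℝ) ≤ x ∧ (t : ℝ) ≤ z
  · rw [min_eq_left ht.1, min_eq_left ht.2, sub_self, norm_zero]
    exact hC
  · have : x ⊓ z ≤ (t : ℝ) := by
      by_contra hlt
      exact ht ⟨(not_le.1 hlt).le.trans inf_le_left, (not_le.1 hlt).le.trans inf_le_right⟩
    exact h _ ⟨le_inf this inf_le_left, inf_le_right.trans le_sup_left⟩
      _ ⟨le_inf this inf_le_right, inf_le_right.trans le_sup_right⟩

/-- If `y' = 0` at `x`, then the stopped function, as an element of `C([a, b]; E)` depending on the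
stopping time, has derivative zero at `x`: by `norm_stopped_sub_le` pointwise differentiability at
the single point `x` suffices. -/
theorem hasDerivAt_stopped_zero (hab : a ≤ b) {y : C(Icc a b, E)} {x : ℝ}
    (h : HasDerivAt (IccExtend hab y) 0 x) : HasDerivAt (fun z => stopped hab z y) 0 x := by
  rw [hasDerivAt_iff_isLittleO] at h ⊢
  simp only [smul_zero, sub_zero] at h ⊢
  rw [Asymptotics.isLittleO_iff] at h ⊢
  intro ε hε
  obtain ⟨δ, hδ, hb⟩ := Metric.eventually_nhds_iff.1 (h (half_pos hε))
  filter_upwards [Metric.ball_mem_nhds x hδ] with z hz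
  have key : ∀ v ∈ uIcc z x, ‖IccExtend hab y v - IccExtend hab y x‖ ≤ ε / 2 * ‖z - x‖ := by
    intro v hv
    have hvz : |v - x| ≤ |z - x| := by
      rw [uIcc_comm] at hv
      exact abs_sub_left_of_mem_uIcc hv
    refine (hb (lt_of_le_of_lt (by simpa [Real.dist_eq] using hvz) hz)).trans ?_
    gcongr
    exact hvz
  refine norm_stopped_sub_le hab fun v hv w hw => ?_
  calc _ = ‖(IccExtend hab y v - IccExtend hab y x) - (IccExtend hab y w - IccExtend hab y x)‖ := by
        rw [sub_sub_sub_cancel_right]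
    _ ≤ _ := norm_sub_le _ _
    _ ≤ ε / 2 * ‖z - x‖ + ε / 2 * ‖z - x‖ := add_le_add (key v hv) (key w hw)
    _ = _ := by ring

theorem IccExtend_primitive (hab : a ≤ b) {g : ℝ → E} (hg : IntervalIntegrable g volume a b)
    {t : ℝ} (ht : t ∈ Icc a b) : IccExtend hab (primitive hab hg) t = ∫ s in a..t, g s := by
  rw [IccExtend_of_mem hab _ ht, primitive_apply]

theorem absolutelyContinuousOnInterval_stopped_primitive (hab : a ≤ b) {g : ℝ → E}
    (hg : IntervalIntegrable g volume a b) :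
    AbsolutelyContinuousOnInterval (fun x => stopped hab x (primitive hab hg)) a b := by
  have hN := hg.norm.absolutelyContinuousOnInterval_intervalIntegral (c := a) left_mem_uIcc
  rw [absolutelyContinuousOnInterval_iff] at hN ⊢
  intro ε hε
  obtain ⟨δ, hδ, h2⟩ := hN ε hε
  refine ⟨δ, hδ, fun I hI hs => lt_of_le_of_lt (Finset.sum_le_sum fun i hi => ?_) (h2 I hI hs)⟩
  obtain ⟨m1, m2⟩ := hI.1 i hi
  have key : ∀ x ∈ uIcc a b, IntervalIntegrable g volume a x := fun x hx =>
    hg.mono_set (uIcc_subset_uIcc left_mem_uIcc hx)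
  rw [dist_eq_norm, Real.dist_eq]
  refine norm_stopped_sub_le hab fun v hv w hw => ?_
  have mv := uIcc_subset_uIcc m1 m2 hv
  have mw := uIcc_subset_uIcc m1 m2 hw
  rw [IccExtend_primitive hab hg (uIcc_of_le hab ▸ mv),
    IccExtend_primitive hab hg (uIcc_of_le hab ▸ mw),
    intervalIntegral.integral_interval_sub_left (key _ mv) (key _ mw),
    intervalIntegral.integral_interval_sub_left (key _ m1).norm (key _ m2).norm]
  refine intervalIntegral.norm_integral_le_abs_integral_norm.trans ?_
  refine intervalIntegral.abs_integral_mono_interval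
    ?_ (.of_forall fun s => norm_nonneg _) ?_
  · rw [uIoc_comm (I.2 i).2]
    exact Ioc_subset_Ioc (le_inf hw.1 hv.1 |>.trans le_rfl) (sup_le hw.2 hv.2)
  · exact (key _ m2).norm.symm.trans (key _ m1).norm

/-- The function `t ↦ t c` on `[a, b]`. -/
noncomputable def linearMotion (a b : ℝ) : E →ₗ[ℂ] C(Icc a b, E) where
  toFun c := ⟨fun t => (t : ℂ) • c, by fun_prop⟩
  map_add' _ _ := by ext; simp
  map_smul' r c := by ext t; exact smul_comm (t : ℂ) r c

theorem IccExtend_linearMotion (hab : a ≤ b) (c : E) {t : ℝ} (ht : t ∈ Icc a b) :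
    IccExtend hab (linearMotion a b c) t = t • c := by
  rw [IccExtend_of_mem hab _ ht]
  simp [linearMotion]

/-- **Riesz representation on primitives.** A continuous functional `T` on `C([a, b]; E)`, evaluated
at the primitive of an integrable function `g`, is the integral of `g` against a bounded density.

The density at `x` is the derivative of `x ↦ T(t ↦ min(t, x) c)`, a Lipschitz function of `x`;
at a point where the primitive `∫_a g` has derivative `g(x)`, the value of `T` at this primitive
stopped at `x` has derivative `h(x) g(x)`. -/
theorem exists_density [FiniteDimensional ℂ E] [FiniteDimensional ℂ E'] (hab : a ≤ b)
    (T : C(Icc a b, E) →L[ℂ] E') :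
    ∃ h : ℝ → E →L[ℂ] E', AEStronglyMeasurable h volume ∧ (∀ s, ‖h s‖ ≤ ‖T‖) ∧
      ∀ (g : ℝ → E) (hg : IntervalIntegrable g volume a b),
        T (primitive hab hg) = ∫ s in a..b, h s (g s) := by
  have : CompleteSpace E := FiniteDimensional.complete ℂ E
  have : CompleteSpace E' := FiniteDimensional.complete ℂ E'
  have : FiniteDimensional ℝ (E →L[ℂ] E') := FiniteDimensional.complexToReal _
  set Φ : ℝ → E →L[ℂ] E' := fun x =>
    LinearMap.toContinuousLinearMap (T.toLinearMap ∘ₗ stopped hab x ∘ₗ linearMotion a b) with hΦ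
  have hΦa : ∀ x c, Φ x c = T (stopped hab x (linearMotion a b c)) := fun x c => rfl
  have hL : LipschitzWith ‖T‖₊ Φ := by
    refine LipschitzWith.of_dist_le_mul fun x z => ?_
    rw [dist_eq_norm, coe_nnnorm]
    refine ContinuousLinearMap.opNorm_le_bound _ (by positivity) fun c => ?_
    rw [_root_.sub_apply, hΦa, hΦa, ← map_sub, mul_assoc]
    refine T.le_opNorm_of_le (norm_stopped_sub_le hab fun v hv w hw => ?_)
    simp only [IccExtend, Function.comp_apply, linearMotion, LinearMap.coe_mk, AddHom.coe_mk,
      ContinuousMap.coe_mk]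
    rw [← sub_smul, norm_smul, ← Complex.ofReal_sub, Complex.norm_real, Real.norm_eq_abs]
    gcongr
    rw [Real.dist_eq, abs_sub_comm x]
    refine (abs_projIcc_sub_projIcc hab).trans ?_
    rw [abs_sub_comm]
    exact abs_sub_le_of_uIcc_subset_uIcc (uIcc_subset_uIcc hv hw)
  refine ⟨deriv Φ, aestronglyMeasurable_deriv _ _, fun s => norm_deriv_le_of_lipschitz hL,
    fun g hg => ?_⟩
  have hac : AbsolutelyContinuousOnInterval (fun x => T (stopped hab x (primitive hab hg))) a b :=
    (absolutelyContinuousOnInterval_stopped_primitive hab hg).clm_comp (T.restrictScalars ℝ)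
  have hint : IntervalIntegrable (fun s => deriv Φ s (g s)) volume a b := by
    refine (hg.norm.const_mul ‖T‖).mono_fun' ?_ ?_
    · exact (ContinuousLinearMap.id ℂ (E →L[ℂ] E')).aestronglyMeasurable_comp₂
        (aestronglyMeasurable_deriv _ _) (intervalIntegrable_iff.1 hg).aestronglyMeasurable
    · filter_upwards with s
      exact (deriv Φ s).le_of_opNorm_le (norm_deriv_le_of_lipschitz hL) _
  have hp := isPrimitiveOn_of_ae_hasDerivAt hab hac hint ?_
  · have e := hp.2 b (right_mem_Icc.2 hab)
    simp only [stopped_right, stopped_left] at e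
    rw [e, IccExtend_primitive hab hg (left_mem_Icc.2 hab)]
    have : ContinuousMap.const (Icc a b) (0 : E) = 0 := rfl
    rw [intervalIntegral.integral_same, this, map_zero, zero_add]
  · filter_upwards [hL.ae_differentiableAt_real, hg.ae_hasDerivAt_integral] with x h1 h2 hx
    have hx' : x ∈ uIcc a b := by rw [uIcc_of_le hab]; exact Ioo_subset_Icc_self hx
    have hnhds := Icc_mem_nhds hx.1 hx.2
    have d1 : HasDerivAt (fun z => Φ z (g x)) (deriv Φ x (g x)) x := by
      exact ((ContinuousLinearMap.apply ℂ E' (g x)).restrictScalars ℝ).hasFDerivAt.comp_hasDerivAt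
        x h1.hasDerivAt
    -- The primitive minus `t ↦ t g(x)` is stationary at `x`.
    have d2 : HasDerivAt (IccExtend hab (primitive hab hg - linearMotion a b (g x))) 0 x := by
      have := (h2 hx' a left_mem_uIcc).sub ((hasDerivAt_id x).smul_const (g x))
      rw [one_smul, sub_self] at this
      refine this.congr_of_eventuallyEq ?_
      filter_upwards [hnhds] with t ht
      simp only [id, Pi.sub_apply, ← IccExtend_primitive hab hg ht,
        ← IccExtend_linearMotion hab (g x) ht]
      rfl
    have d3 := ((T.restrictScalars ℝ).hasFDerivAt.comp_hasDerivAt x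
      (hasDerivAt_stopped_zero hab d2)).add d1
    simp only [map_zero, zero_add] at d3
    refine d3.congr_of_eventuallyEq (.of_forall fun z => ?_)
    simp [hΦa]

end Representation

/-! ### Fundamental solutions -/

section Fundamental

variable {E : Type*} [NormedAddCommGroup E] [NormedSpace ℂ E] {a b : ℝ}

theorem intervalIntegrable_bilin {F G H : Type*} [NormedAddCommGroup F] [NormedSpace ℂ F]
    [NormedAddCommGroup G] [NormedSpace ℂ G] [NormedAddCommGroup H] [NormedSpace ℂ H]
    (L : F →L[ℂ] G →L[ℂ] H) {u : ℝ → F} {v : ℝ → G} {C : ℝ}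
    (hu : AEStronglyMeasurable u volume) (hC : ∀ s, ‖u s‖ ≤ C)
    (hv : IntervalIntegrable v volume a b) :
    IntervalIntegrable (fun s => L (u s) (v s)) volume a b := by
  refine (hv.norm.const_mul (‖L‖ * C)).mono_fun'
    (L.aestronglyMeasurable_comp₂ hu.restrict (intervalIntegrable_iff.1 hv).aestronglyMeasurable) ?_
  filter_upwards with s
  refine (L.le_opNorm₂ _ _).trans ?_
  gcongr
  exact hC s

theorem intervalIntegrable_clm {F G : Type*} [NormedAddCommGroup F] [NormedSpace ℂ F]
    [NormedAddCommGroup G] [NormedSpace ℂ G] (L : F →L[ℂ] G) {v : ℝ → F}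
    (hv : IntervalIntegrable v volume a b) : IntervalIntegrable (fun s => L (v s)) volume a b :=
  intervalIntegrable_bilin (ContinuousLinearMap.id ℂ (F →L[ℂ] G)) (u := fun _ => L)
    aestronglyMeasurable_const (fun _ => le_rfl) hv

/-- The fundamental solution `Y' = A Y`, `Y(a) = 1` of a linear system, as an operator-valued
continuous function. -/
noncomputable def fundamental (hab : a ≤ b) {A : ℝ → E →L[ℂ] E}
    (hA : IntervalIntegrable A volume a b) : C(Icc a b, E →L[ℂ] E) :=
  linearSolution hab (intervalIntegrable_clm (ContinuousLinearMap.mul ℂ (E →L[ℂ] E)) hA) 1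

theorem fundamental_left [CompleteSpace E] (hab : a ≤ b) {A : ℝ → E →L[ℂ] E}
    (hA : IntervalIntegrable A volume a b) : IccExtend hab (fundamental hab hA) a = 1 :=
  linearSolution_left _ _ _

theorem isPrimitiveOn_fundamental [CompleteSpace E] (hab : a ≤ b) {A : ℝ → E →L[ℂ] E}
    (hA : IntervalIntegrable A volume a b) :
    IsPrimitiveOn a b (IccExtend hab (fundamental hab hA))
      (fun s => A s * IccExtend hab (fundamental hab hA) s) :=
  isPrimitiveOn_linearSolution _ _ _

theorem eq_fundamental [CompleteSpace E] (hab : a ≤ b) {A : ℝ → E →L[ℂ] E}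
    (hA : IntervalIntegrable A volume a b) {Y : C(Icc a b, E →L[ℂ] E)}
    (hY : IsPrimitiveOn a b (IccExtend hab Y) (fun s => A s * IccExtend hab Y s))
    (h1 : IccExtend hab Y a = 1) : Y = fundamental hab hA := by
  refine eq_of_isPrimitiveOn hab
    (intervalIntegrable_clm (ContinuousLinearMap.mul ℂ (E →L[ℂ] E)) hA) (f := 0) ?_ ?_
    (h1.trans (fundamental_left hab hA).symm)
  · simpa using hY
  · simpa using isPrimitiveOn_fundamental hab hA

/-- The product rule for operator-valued functions. -/
theorem IsPrimitiveOn.mul [CompleteSpace E] (hab : a ≤ b) {u u' v v' : ℝ → E →L[ℂ] E}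
    (hu : IsPrimitiveOn a b u u') (hv : IsPrimitiveOn a b v v') :
    IsPrimitiveOn a b (fun t => u t * v t) (fun t => u t * v' t + u' t * v t) :=
  IsPrimitiveOn.bilin hab ((ContinuousLinearMap.mul ℂ (E →L[ℂ] E)).bilinearRestrictScalars ℝ) hu hv

/-- The solution `X` of the adjoint equation `X' = -X A`, `X(a) = 1` satisfies `X Y = 1`, as the
derivative of `X Y` vanishes; so the fundamental solution is invertible. -/
theorem isUnit_fundamental [FiniteDimensional ℂ E] (hab : a ≤ b) {A : ℝ → E →L[ℂ] E}
    (hA : IntervalIntegrable A volume a b) : IsUnit (fundamental hab hA) := by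
  have : CompleteSpace E := FiniteDimensional.complete ℂ E
  have hB := intervalIntegrable_clm (F := E →L[ℂ] E)
    (G := (E →L[ℂ] E) →L[ℂ] E →L[ℂ] E) (-(ContinuousLinearMap.mul ℂ (E →L[ℂ] E)).flip) hA
  set X := linearSolution hab hB 1 with hX
  set Y := fundamental hab hA with hY
  have hp := (isPrimitiveOn_linearSolution hab hB 1).mul hab (isPrimitiveOn_fundamental hab hA)
  have hXY : ∀ t, X t * Y t = 1 := fun t => by
    have e := hp.2 t t.2
    rw [IccExtend_val, IccExtend_val, fundamental_left, linearSolution_left] at e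
    rw [e, one_mul, add_eq_left]
    refine (intervalIntegral.integral_congr (g := fun _ => 0) fun s _ => ?_).trans (by simp)
    simp [← mul_assoc]
  -- A left inverse of an operator on a finite-dimensional space is a right inverse.
  have hYX : ∀ t, Y t * X t = 1 := fun t => by
    have h1 : (X t : E →ₗ[ℂ] E) * (Y t : E →ₗ[ℂ] E) = 1 := by
      ext v
      exact congrArg (fun f : E →L[ℂ] E => f v) (hXY t)
    rw [mul_eq_one_comm] at h1
    ext v
    exact congrArg (fun f : E →ₗ[ℂ] E => f v) h1
  exact ⟨⟨Y, X, ContinuousMap.ext hYX, ContinuousMap.ext hXY⟩, rfl⟩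

theorem intervalIntegrable_norm_mul_sub {𝔐 : Type*} [NormedRing 𝔐] [NormedAlgebra ℂ 𝔐]
    {u v : ℝ → 𝔐} (hu : IntervalIntegrable u volume a b) (hv : IntervalIntegrable v volume a b) :
    IntervalIntegrable
      (fun s => ‖ContinuousLinearMap.mul ℂ 𝔐 (u s) - ContinuousLinearMap.mul ℂ 𝔐 (v s)‖)
      volume a b :=
  ((intervalIntegrable_clm _ hu).sub (intervalIntegrable_clm _ hv)).norm

theorem apply_mul_inverse {𝔐 : Type*} [NormedRing 𝔐] {Y : C(Icc a b, 𝔐)} (hY : IsUnit Y)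
    (t : Icc a b) : Y t * Ring.inverse Y t = 1 :=
  congrArg (fun f : C(Icc a b, 𝔐) => f t) (Ring.mul_inverse_cancel Y hY)

theorem tendsto_ringInverse {𝔐 ι : Type*} [NormedRing 𝔐] [CompleteSpace 𝔐] {l : Filter ι}
    {x : ι → 𝔐} {x₀ : 𝔐} (h₀ : IsUnit x₀) (h : Tendsto x l (𝓝 x₀)) :
    Tendsto (fun i => Ring.inverse (x i)) l (𝓝 (Ring.inverse x₀)) := by
  obtain ⟨u, rfl⟩ := h₀
  exact (NormedRing.inverse_continuousAt u).tendsto.comp h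

theorem tendsto_norm_inverse_sub_one {𝔐 ι : Type*} [NormedRing 𝔐] [CompleteSpace 𝔐] {l : Filter ι}
    {Z : ι → 𝔐} (h : Tendsto Z l (𝓝 1)) (K : ℝ) :
    Tendsto (fun i => (‖Ring.inverse (Z i) - 1‖ * ‖Z i‖ + ‖Z i - 1‖) * K) l (𝓝 0) := by
  have hinv := tendsto_ringInverse isUnit_one h
  rw [Ring.inverse_one] at hinv
  simpa using ((((hinv.sub_const 1).norm).mul h.norm).add ((h.sub_const 1).norm)).mul_const K

theorem intervalIntegrable_conj (hab : a ≤ b) {A : ℝ → E →L[ℂ] E}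
    (hA : IntervalIntegrable A volume a b) (X Z : C(Icc a b, E →L[ℂ] E)) :
    IntervalIntegrable
      (fun s => IccExtend hab X s * (A s * IccExtend hab Z s)) volume a b :=
  intervalIntegrable_bilin (ContinuousLinearMap.mul ℂ (E →L[ℂ] E))
    (continuous_IccExtend hab _).aestronglyMeasurable (norm_IccExtend_le hab _)
    (intervalIntegrable_bilin (ContinuousLinearMap.mul ℂ (E →L[ℂ] E)).flip
      (continuous_IccExtend hab _).aestronglyMeasurable (norm_IccExtend_le hab _) hA)

/-- If `Z` is the fundamental solution for `R`, then the substitution `Y = Z W` reduces the equation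
`Y' = (R + A) Y` to `W' = (Z⁻¹ A Z) W`. -/
theorem fundamental_mul_conj [FiniteDimensional ℂ E] (hab : a ≤ b) {R A S : ℝ → E →L[ℂ] E}
    (hR : IntervalIntegrable R volume a b) (hA : IntervalIntegrable A volume a b)
    (hS : IntervalIntegrable S volume a b) (h : ∀ s, S s = R s + A s) :
    fundamental hab hR * fundamental hab (intervalIntegrable_conj hab hA
      (Ring.inverse (fundamental hab hR)) (fundamental hab hR)) = fundamental hab hS := by
  have : CompleteSpace E := FiniteDimensional.complete ℂ E
  refine eq_fundamental hab hS ?_ ?_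
  · refine ((isPrimitiveOn_fundamental hab hR).mul hab (isPrimitiveOn_fundamental hab
      (intervalIntegrable_conj hab hA (Ring.inverse (fundamental hab hR))
      (fundamental hab hR)))).congr hab (fun t _ => rfl)
      fun t _ => ?_
    obtain ⟨X, hX⟩ : ∃ X, X = Ring.inverse (fundamental hab hR) := ⟨_, rfl⟩
    rw [← hX]
    have e : IccExtend hab (fundamental hab hR) t * IccExtend hab X t = 1 := by
      rw [hX]
      exact apply_mul_inverse (isUnit_fundamental hab hR) _
    have e2 : ∀ V W : C(Icc a b, E →L[ℂ] E),
      IccExtend hab ⇑(V * W) t = IccExtend hab V t * IccExtend hab W t := fun _ _ => rfl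
    rw [e2, h]
    generalize IccExtend hab (fundamental hab (intervalIntegrable_conj hab hA _ _)) t = W
    rw [← mul_assoc, ← mul_assoc, e, one_mul]
    noncomm_ring
  · exact (congrArg₂ (· * ·) (fundamental_left hab hR) (fundamental_left hab _)).trans (one_mul 1)

/-- If the fundamental solutions for `R i` tend to `1` uniformly, then those for `R i + A` tend to
the fundamental solution for `A`: the coefficients `Z⁻¹ A Z` of the transformed
equation tend to `A` in `L¹`, although the `R i` need not be small in `L¹`. -/
theorem tendsto_fundamental [FiniteDimensional ℂ E] {ι : Type*} {l : Filter ι} (hab : a ≤ b)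
    {R S : ι → ℝ → E →L[ℂ] E} {A : ℝ → E →L[ℂ] E}
    (hR : ∀ i, IntervalIntegrable (R i) volume a b) (hA : IntervalIntegrable A volume a b)
    (hS : ∀ i, IntervalIntegrable (S i) volume a b) (h : ∀ i s, S i s = R i s + A s)
    (hlim : Tendsto (fun i => fundamental hab (hR i)) l (𝓝 1)) :
    Tendsto (fun i => fundamental hab (hS i)) l (𝓝 (fundamental hab hA)) := by
  have : CompleteSpace E := FiniteDimensional.complete ℂ E
  set Z := fun i => fundamental hab (hR i) with hZ
  have hW : Tendsto (fun i => fundamental hab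
      (intervalIntegrable_conj hab hA (Ring.inverse (Z i)) (Z i))) l
      (𝓝 (fundamental hab hA)) := by
    refine tendsto_linearSolution hab _ _ ?_ _
    refine squeeze_zero (fun i => intervalIntegral.integral_nonneg hab fun _ _ => norm_nonneg _)
      (fun i => ?_) (tendsto_norm_inverse_sub_one (𝔐 := C(Icc a b, E →L[ℂ] E)) hlim
        (∫ s in a..b, ‖A s‖))
    obtain ⟨X, hX⟩ : ∃ X, X = Ring.inverse (Z i) := ⟨_, rfl⟩
    rw [← hX]
    have hpt : ∀ s, ‖ContinuousLinearMap.mul ℂ (E →L[ℂ] E)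
        (IccExtend hab X s * (A s * IccExtend hab (Z i) s)) -
        ContinuousLinearMap.mul ℂ (E →L[ℂ] E) (A s)‖ ≤
          (‖X - 1‖ * ‖Z i‖ + ‖Z i - 1‖) * ‖A s‖ := fun s => by
      rw [← map_sub]
      set z := IccExtend hab (Z i) s
      set x := IccExtend hab X s
      have hz : ‖z‖ ≤ ‖Z i‖ := norm_IccExtend_le hab _ _
      have hz1 : ‖z - 1‖ ≤ ‖Z i - 1‖ := norm_IccExtend_le hab (Z i - 1) s
      have hx1 : ‖x - 1‖ ≤ ‖X - 1‖ := norm_IccExtend_le hab (X - 1) s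
      have e : x * (A s * z) - A s = (x - 1) * (A s * z) + A s * (z - 1) := by noncomm_ring
      calc _ ≤ ‖(x - 1) * (A s * z) + A s * (z - 1)‖ := by
            rw [e]
            exact ContinuousLinearMap.opNorm_mul_apply_le ℂ (E →L[ℂ] E) _
        _ ≤ ‖x - 1‖ * (‖A s‖ * ‖z‖) + ‖A s‖ * ‖z - 1‖ := (norm_add_le _ _).trans
          (add_le_add ((norm_mul_le _ _).trans (by gcongr; exact norm_mul_le _ _))
            (norm_mul_le _ _))
        _ ≤ ‖X - 1‖ * (‖A s‖ * ‖Z i‖) + ‖A s‖ * ‖Z i - 1‖ := by gcongr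
        _ = _ := by ring
    rw [← intervalIntegral.integral_const_mul]
    exact intervalIntegral.integral_mono_on hab
      (intervalIntegrable_norm_mul_sub (intervalIntegrable_conj hab hA X (Z i)) hA)
      (hA.norm.const_mul _) fun s _ => hpt s
  have := hlim.mul hW
  rw [show (1 : C(Icc a b, E →L[ℂ] E)) * fundamental hab hA = _ from
    ContinuousMap.ext fun _ => one_mul _] at this
  refine this.congr fun i => ?_
  exact fundamental_mul_conj hab (hR i) hA (hS i) (h i)

end Fundamental

/-! ### Green kernels -/

section Green

variable {E : Type*} [NormedAddCommGroup E] [NormedSpace ℂ E] {a b : ℝ}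

/-- The pointwise action of operator-valued functions on vector-valued functions, as a bounded
bilinear map. -/
noncomputable def pointwiseAction (E : Type*) [NormedAddCommGroup E] [NormedSpace ℂ E] (a b : ℝ) :
    C(Icc a b, E →L[ℂ] E) →L[ℂ] C(Icc a b, E) →L[ℂ] C(Icc a b, E) :=
  LinearMap.mkContinuous₂
    (LinearMap.mk₂ ℂ (fun (Y : C(Icc a b, E →L[ℂ] E)) (φ : C(Icc a b, E)) =>
        (⟨fun t => Y t (φ t), by fun_prop⟩ : C(Icc a b, E)))
      (fun _ _ _ => by ext; simp) (fun _ _ _ => by ext; simp) (fun _ _ _ => by ext; simp)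
      (fun _ _ _ => by ext; simp))
    1 fun Y φ => by
      rw [one_mul]
      exact (ContinuousMap.norm_le _ (by positivity)).2 fun t =>
        ((Y t).le_opNorm _).trans (by
          gcongr
          · exact Y.norm_coe_le_norm t
          · exact φ.norm_coe_le_norm t)

theorem pointwiseAction_apply (Y : C(Icc a b, E →L[ℂ] E)) (φ : C(Icc a b, E)) (t : Icc a b) :
    pointwiseAction E a b Y φ t = Y t (φ t) := rfl

/-- The characteristic operator `c ↦ U(Y c)` of the boundary value problem with fundamental
solution `Y`. -/
noncomputable def characteristicOperator (U : C(Icc a b, E) →L[ℂ] E) (Y : C(Icc a b, E →L[ℂ] E)) :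
    E →L[ℂ] E :=
  (U ∘L pointwiseAction E a b Y) ∘L ContinuousLinearMap.const ℂ (Icc a b)

/-- `h` is a bounded density of the functional `T` on primitives of integrable functions. -/
structure IsDensity (hab : a ≤ b) (T : C(Icc a b, E) →L[ℂ] E) (h : ℝ → E →L[ℂ] E) : Prop where
  aestronglyMeasurable : AEStronglyMeasurable h volume
  exists_bound : ∃ C, ∀ s, ‖h s‖ ≤ C
  apply_primitive : ∀ (g : ℝ → E) (hg : IntervalIntegrable g volume a b),
    T (primitive hab hg) = ∫ s in a..b, h s (g s)

theorem intervalIntegrable_bounded_apply {h : ℝ → E →L[ℂ] E} {C : ℝ}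
    (hh : AEStronglyMeasurable h volume) (hC : ∀ s, ‖h s‖ ≤ C) {g : ℝ → E}
    (hg : IntervalIntegrable g volume a b) : IntervalIntegrable (fun s => h s (g s)) volume a b :=
  intervalIntegrable_bilin (ContinuousLinearMap.id ℂ (E →L[ℂ] E)) hh hC hg

theorem IsDensity.add {hab : a ≤ b} {T T' : C(Icc a b, E) →L[ℂ] E} {h h' : ℝ → E →L[ℂ] E}
    (H : IsDensity hab T h) (H' : IsDensity hab T' h') :
    IsDensity hab (T + T') (fun s => h s + h' s) := by
  obtain ⟨C, hC⟩ := H.exists_bound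
  obtain ⟨C', hC'⟩ := H'.exists_bound
  refine ⟨H.1.add H'.1, ⟨C + C', fun s => (norm_add_le _ _).trans (add_le_add (hC s) (hC' s))⟩,
    fun g hg => ?_⟩
  rw [_root_.add_apply, H.3 g hg, H'.3 g hg, ← intervalIntegral.integral_add
    (intervalIntegrable_bounded_apply H.1 hC hg) (intervalIntegrable_bounded_apply H'.1 hC' hg)]
  rfl

/-- The kernel `Y(t) (1_{s ≤ t} - N h(s)) Y(s)⁻¹`, where `Y` is a fundamental solution. It is the
Green kernel if `N` inverts the characteristic operator and `h` is a density of `φ ↦ U(Y φ)`. -/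
noncomputable def greenKernel (hab : a ≤ b) (Y : C(Icc a b, E →L[ℂ] E)) (N : E →L[ℂ] E)
    (h : ℝ → E →L[ℂ] E) (t s : ℝ) : E →L[ℂ] E :=
  IccExtend hab Y t * ((Iic t).indicator (fun _ => 1) s - N * h s) *
    IccExtend hab (⇑(Ring.inverse Y)) s

/-- The coordinate-free form of the notion of a Green matrix, with an everywhere bounded kernel. -/
structure IsGreenKernel (hab : a ≤ b) (A : ℝ → E →L[ℂ] E) (U : C(Icc a b, E) →L[ℂ] E)
    (G : ℝ → ℝ → E →L[ℂ] E) : Prop where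
  aestronglyMeasurable : AEStronglyMeasurable (fun p : ℝ × ℝ => G p.1 p.2) volume
  exists_bound : ∃ C, ∀ t s, ‖G t s‖ ≤ C
  representation : ∀ f : ℝ → E, IntervalIntegrable f volume a b →
    ∃ y : C(Icc a b, E),
      (IsPrimitiveOn a b (IccExtend hab y) (fun s => A s (IccExtend hab y s) + f s) ∧ U y = 0) ∧
      (∀ z : C(Icc a b, E),
        IsPrimitiveOn a b (IccExtend hab z) (fun s => A s (IccExtend hab z s) + f s) ∧ U z = 0 →
          z = y) ∧
      ∀ t : Icc a b, IntervalIntegrable (fun s => G t s (f s)) volume a b ∧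
        y t = ∫ s in a..b, G t s (f s)

theorem norm_indicator_one_le (t s : ℝ) :
    ‖(Iic t).indicator (fun _ => (1 : E →L[ℂ] E)) s‖ ≤ 1 :=
  (norm_indicator_le_norm_self _ _).trans ContinuousLinearMap.norm_id_le

theorem norm_greenKernel_le (hab : a ≤ b) (Y : C(Icc a b, E →L[ℂ] E)) (N : E →L[ℂ] E)
    {h : ℝ → E →L[ℂ] E} {C : ℝ} (hC : ∀ s, ‖h s‖ ≤ C) (t s : ℝ) :
    ‖greenKernel hab Y N h t s‖ ≤ ‖Y‖ * (1 + ‖N‖ * C) * ‖Ring.inverse Y‖ := by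
  have hC0 : 0 ≤ C := (norm_nonneg _).trans (hC s)
  refine (norm_mul_le _ _).trans ?_
  gcongr
  · refine (norm_mul_le _ _).trans ?_
    gcongr
    · exact norm_IccExtend_le hab Y t
    · refine (norm_sub_le _ _).trans (add_le_add (norm_indicator_one_le t s) ?_)
      exact (norm_mul_le _ _).trans (by gcongr; exact hC s)
  · exact norm_IccExtend_le hab _ s

/-- Quantitative continuity of the kernel in `Y`, `N`, `h`, uniformly in `t` and `s`. -/
theorem norm_greenKernel_sub_le (hab : a ≤ b) (Y Y₀ : C(Icc a b, E →L[ℂ] E)) (N N₀ : E →L[ℂ] E)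
    {h h₀ : ℝ → E →L[ℂ] E} {C τ : ℝ} (hC : ∀ s, ‖h₀ s‖ ≤ C) (hτ : ∀ s, ‖h s - h₀ s‖ ≤ τ) (t s : ℝ) :
    ‖greenKernel hab Y N h t s - greenKernel hab Y₀ N₀ h₀ t s‖ ≤
      ‖Y - Y₀‖ * (1 + ‖N‖ * (C + τ)) * ‖Ring.inverse Y‖ +
      ‖Y₀‖ * (‖N - N₀‖ * (C + τ) + ‖N₀‖ * τ) * ‖Ring.inverse Y‖ +
      ‖Y₀‖ * (1 + ‖N₀‖ * C) * ‖Ring.inverse Y - Ring.inverse Y₀‖ := by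
  unfold greenKernel
  have hC0 : 0 ≤ C := (norm_nonneg _).trans (hC s)
  have hτ0 : 0 ≤ τ := (norm_nonneg _).trans (hτ s)
  have hh : ‖h s‖ ≤ C + τ := by
    have := norm_add_le (h₀ s) (h s - h₀ s)
    rw [add_sub_cancel] at this
    exact this.trans (add_le_add (hC s) (hτ s))
  have hy : ‖IccExtend hab Y t - IccExtend hab Y₀ t‖ ≤ ‖Y - Y₀‖ := norm_IccExtend_le hab (Y - Y₀) t
  have hy0 : ‖IccExtend hab Y₀ t‖ ≤ ‖Y₀‖ := norm_IccExtend_le hab Y₀ t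
  have hx : ‖IccExtend hab (⇑(Ring.inverse Y)) s‖ ≤ ‖Ring.inverse Y‖ := norm_IccExtend_le hab _ s
  have hx0 : ‖IccExtend hab (⇑(Ring.inverse Y)) s - IccExtend hab (⇑(Ring.inverse Y₀)) s‖ ≤
      ‖Ring.inverse Y - Ring.inverse Y₀‖ :=
    norm_IccExtend_le hab (Ring.inverse Y - Ring.inverse Y₀) s
  have hi := norm_indicator_one_le (E := E) t s
  generalize (Iic t).indicator (fun _ => (1 : E →L[ℂ] E)) s = χ at *
  generalize IccExtend hab Y t = y at *
  generalize IccExtend hab Y₀ t = y₀ at *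
  generalize IccExtend hab (⇑(Ring.inverse Y)) s = x at *
  generalize IccExtend hab (⇑(Ring.inverse Y₀)) s = x₀ at *
  have hτs := hτ s
  have hCs := hC s
  generalize h s = k at *
  generalize h₀ s = k₀ at *
  -- The difference of the products telescopes, one factor being changed at a time.
  have e : y * (χ - N * k) * x - y₀ * (χ - N₀ * k₀) * x₀ =
      (y - y₀) * (χ - N * k) * x - y₀ * ((N - N₀) * k + N₀ * (k - k₀)) * x +
        y₀ * (χ - N₀ * k₀) * (x - x₀) := by noncomm_ring
  have m3 : ∀ u v w : E →L[ℂ] E, ‖u * v * w‖ ≤ ‖u‖ * ‖v‖ * ‖w‖ := fun u v w =>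
    (norm_mul_le _ _).trans (by gcongr; exact norm_mul_le _ _)
  have h1 : ‖χ - N * k‖ ≤ 1 + ‖N‖ * (C + τ) :=
    (norm_sub_le _ _).trans (add_le_add hi ((norm_mul_le _ _).trans (by gcongr)))
  have h2 : ‖(N - N₀) * k + N₀ * (k - k₀)‖ ≤ ‖N - N₀‖ * (C + τ) + ‖N₀‖ * τ :=
    (norm_add_le _ _).trans (add_le_add ((norm_mul_le _ _).trans (by gcongr))
      ((norm_mul_le _ _).trans (by gcongr)))
  have h3 : ‖χ - N₀ * k₀‖ ≤ 1 + ‖N₀‖ * C :=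
    (norm_sub_le _ _).trans (add_le_add hi ((norm_mul_le _ _).trans (by gcongr)))
  rw [e]
  refine (norm_add_le _ _).trans (add_le_add ((norm_sub_le _ _).trans (add_le_add ?_ ?_)) ?_)
  · exact (m3 _ _ _).trans (by gcongr)
  · exact (m3 _ _ _).trans (by gcongr)
  · exact (m3 _ _ _).trans (by gcongr)

theorem aestronglyMeasurable_greenKernel (hab : a ≤ b) (Y : C(Icc a b, E →L[ℂ] E))
    (N : E →L[ℂ] E) {h : ℝ → E →L[ℂ] E} (hh : AEStronglyMeasurable h volume) :
    AEStronglyMeasurable (fun p : ℝ × ℝ => greenKernel hab Y N h p.1 p.2) volume := by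
  unfold greenKernel
  refine AEStronglyMeasurable.mul (AEStronglyMeasurable.mul ?_ (AEStronglyMeasurable.sub ?_ ?_)) ?_
  · exact ((continuous_IccExtend hab Y).comp continuous_fst).aestronglyMeasurable
  · have : (fun p : ℝ × ℝ => (Iic p.1).indicator (fun _ => (1 : E →L[ℂ] E)) p.2) =
        {p : ℝ × ℝ | p.2 ≤ p.1}.indicator fun _ => 1 := by
      ext1 p
      simp [indicator]
    rw [this]
    exact aestronglyMeasurable_const.indicator (measurableSet_le measurable_snd measurable_fst)
  · exact (hh.comp_quasiMeasurePreserving Measure.quasiMeasurePreserving_snd).const_mul N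
  · exact ((continuous_IccExtend hab _).comp continuous_snd).aestronglyMeasurable

/-- Variation of constants: `y = Y (c + ∫_a Y⁻¹ f)` solves `y' = A y + f`, `y(a) = c`. Only the
derivative of `Y` is needed, `Y⁻¹` enters as a continuous function. -/
theorem isPrimitiveOn_variation [FiniteDimensional ℂ E] (hab : a ≤ b) {A : ℝ → E →L[ℂ] E}
    (hA : IntervalIntegrable A volume a b) {f : ℝ → E}
    (hg : IntervalIntegrable
      (fun s => IccExtend hab (⇑(Ring.inverse (fundamental hab hA))) s (f s)) volume a b) (c : E)
    {y : C(Icc a b, E)} (hy : y = pointwiseAction E a b (fundamental hab hA)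
      (ContinuousMap.const _ c + primitive hab hg)) :
    IsPrimitiveOn a b (IccExtend hab y) (fun s => A s (IccExtend hab y s) + f s) ∧
      IccExtend hab y a = c := by
  have : CompleteSpace E := FiniteDimensional.complete ℂ E
  have hU := isUnit_fundamental hab hA
  set v := ContinuousMap.const (Icc a b) c + primitive hab hg with hv
  have hva : IccExtend hab v a = c := by
    rw [IccExtend_of_mem hab _ (left_mem_Icc.2 hab)]
    simp [hv]
  have hvp : IsPrimitiveOn a b (IccExtend hab v) _ := ⟨hg, fun t ht => by
    rw [hva, IccExtend_of_mem hab _ ht]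
    rfl⟩
  have hyv : ∀ t, IccExtend hab y t = IccExtend hab (fundamental hab hA) t (IccExtend hab v t) :=
    fun t => by rw [hy]; rfl
  refine ⟨?_, ?_⟩
  · refine (IsPrimitiveOn.bilin hab
      ((ContinuousLinearMap.id ℂ (E →L[ℂ] E)).bilinearRestrictScalars ℝ)
      (isPrimitiveOn_fundamental hab hA) hvp).congr hab (fun t _ => (hyv t).symm) fun t _ => ?_
    have e : IccExtend hab (fundamental hab hA) t *
      IccExtend hab (⇑(Ring.inverse (fundamental hab hA))) t = 1 := apply_mul_inverse hU _
    have e' := congrArg (fun L : E →L[ℂ] E => L (f t)) e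
    rw [hyv, add_comm]
    exact congrArg _ e'
  · rw [hyv, fundamental_left, hva]
    rfl

/-- Solutions are `y = Y (c + w)` with `w = ∫_a Y⁻¹ f`. The boundary condition reads
`M c + U(Y w) = 0` with the characteristic operator `M`, and `U(Y w)` is the integral of the density
`h` against `Y⁻¹ f`. -/
theorem isGreenKernel_greenKernel [FiniteDimensional ℂ E] (hab : a ≤ b) {A : ℝ → E →L[ℂ] E}
    (hA : IntervalIntegrable A volume a b) {U : C(Icc a b, E) →L[ℂ] E} {h : ℝ → E →L[ℂ] E}
    (hh : IsDensity hab (U ∘L pointwiseAction E a b (fundamental hab hA)) h)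
    (hM : IsUnit (characteristicOperator U (fundamental hab hA))) :
    IsGreenKernel hab A U (greenKernel hab (fundamental hab hA)
      (Ring.inverse (characteristicOperator U (fundamental hab hA))) h) := by
  have : CompleteSpace E := FiniteDimensional.complete ℂ E
  obtain ⟨C, hC⟩ := hh.exists_bound
  refine ⟨aestronglyMeasurable_greenKernel hab _ _ hh.1, ⟨_, norm_greenKernel_le hab _ _ hC⟩,
    fun f hf => ?_⟩
  have hg : IntervalIntegrable
      (fun s => IccExtend hab (⇑(Ring.inverse (fundamental hab hA))) s (f s)) volume a b :=
    intervalIntegrable_bounded_apply (continuous_IccExtend hab _).aestronglyMeasurable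
      (norm_IccExtend_le hab _) hf
  have hvar := fun c => isPrimitiveOn_variation hab hA hg c rfl
  set Y := fundamental hab hA with hY
  set M := characteristicOperator U Y with hMdef
  set g := fun s => IccExtend hab (⇑(Ring.inverse Y)) s (f s) with hgdef
  set J := ∫ s in a..b, h s (g s) with hJ
  have hhg := intervalIntegrable_bounded_apply hh.1 hC hg
  have hUy : ∀ c, U (pointwiseAction E a b Y (ContinuousMap.const _ c + primitive hab hg)) =
      M c + J := fun c => by
    rw [map_add, map_add, hJ, ← hh.3 g hg]
    rfl
  have hMN : ∀ v, M (Ring.inverse M v) = v := fun v =>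
    congrArg (fun L : E →L[ℂ] E => L v) (Ring.mul_inverse_cancel M hM)
  have hNM : ∀ v, Ring.inverse M (M v) = v := fun v =>
    congrArg (fun L : E →L[ℂ] E => L v) (Ring.inverse_mul_cancel M hM)
  refine ⟨pointwiseAction E a b Y (ContinuousMap.const _ (-Ring.inverse M J) + primitive hab hg),
    ⟨(hvar _).1, ?_⟩, fun z hz => ?_, fun t => ?_⟩
  · rw [hUy, map_neg, hMN, neg_add_cancel]
  · have hz' := eq_of_isPrimitiveOn hab hA hz.1 (hvar (IccExtend hab z a)).1 (hvar _).2.symm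
    have h0 := hz.2
    rw [hz', hUy] at h0
    have h1 : IccExtend hab z a = -Ring.inverse M J := by
      rw [← hNM (IccExtend hab z a), eq_neg_of_add_eq_zero_left h0, map_neg]
    rw [← h1]
    exact hz'
  · have hind : IntervalIntegrable ((Iic (t : ℝ)).indicator g) volume a b :=
      ⟨hg.1.indicator measurableSet_Iic, hg.2.indicator measurableSet_Iic⟩
    have hfun : (fun s => greenKernel hab Y (Ring.inverse M) h t s (f s)) =
        fun s => Y t ((Iic (t : ℝ)).indicator g s - Ring.inverse M (h s (g s))) := by
      ext1 s
      simp only [greenKernel, IccExtend_val, mul_apply_eq_comp, hgdef]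
      by_cases hs : s ∈ Iic (t : ℝ)
      · simp [indicator_of_mem hs]
      · simp [indicator_of_notMem hs]
    have hsub := hind.sub (intervalIntegrable_clm (Ring.inverse M) hhg)
    rw [hfun]
    refine ⟨intervalIntegrable_clm (Y t) hsub, ?_⟩
    rw [pointwiseAction_apply, ContinuousLinearMap.intervalIntegral_comp_comm _ hsub,
      intervalIntegral.integral_sub hind (intervalIntegrable_clm (Ring.inverse M) hhg),
      ContinuousLinearMap.intervalIntegral_comp_comm _ hhg, ContinuousMap.add_apply,
      ContinuousMap.const_apply, primitive_apply, neg_add_eq_sub]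
    congr 2
    exact (intervalIntegral.integral_indicator (f := g) (show (t : ℝ) ∈ Icc a b from t.2)).symm

end Green

/-! ### Convergence of Green kernels -/

section Limits

variable {ι : Type*} {l : Filter ι}

theorem tendsto_clm_comp {F G H : Type*} [NormedAddCommGroup F] [NormedSpace ℂ F]
    [NormedAddCommGroup G] [NormedSpace ℂ G] [NormedAddCommGroup H] [NormedSpace ℂ H]
    {S : ι → G →L[ℂ] H} {S₀ : G →L[ℂ] H} {T : ι → F →L[ℂ] G} {T₀ : F →L[ℂ] G}
    (hS : Tendsto S l (𝓝 S₀)) (hT : Tendsto T l (𝓝 T₀)) :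
    Tendsto (fun i => S i ∘L T i) l (𝓝 (S₀ ∘L T₀)) :=
  ((ContinuousLinearMap.compL ℂ F G H).continuous₂.tendsto (S₀, T₀)).comp (hS.prodMk_nhds hT)

theorem tendsto_norm_clm_sub_iff {F G : Type*} [NormedAddCommGroup F] [NormedSpace ℂ F]
    [NormedAddCommGroup G] [NormedSpace ℂ G] {S : ι → F →L[ℂ] G} {S₀ : F →L[ℂ] G} :
    Tendsto (fun i => ‖S i - S₀‖) l (𝓝 0) ↔ Tendsto S l (𝓝 S₀) :=
  tendsto_iff_norm_sub_tendsto_zero.symm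

/-- The error bound for Green kernels tends to zero together with the errors of its ingredients:
`y`, `x`, `n`, `t` stand for the fundamental solution, its inverse, the inverse of the
characteristic operator and the norm of the change of the functional. -/
theorem tendsto_error {B D : Type*} [NormedRing B] [NormedRing D] {y x : ι → B} {y₀ x₀ : B}
    {n : ι → D} {n₀ : D} {t : ι → ℝ} (hy : Tendsto y l (𝓝 y₀)) (hx : Tendsto x l (𝓝 x₀))
    (hn : Tendsto n l (𝓝 n₀)) (ht : Tendsto t l (𝓝 0)) (C : ℝ) :
    Tendsto (fun i => ‖y i - y₀‖ * (1 + ‖n i‖ * (C + t i)) * ‖x i‖ +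
      ‖y₀‖ * (‖n i - n₀‖ * (C + t i) + ‖n₀‖ * t i) * ‖x i‖ +
      ‖y₀‖ * (1 + ‖n₀‖ * C) * ‖x i - x₀‖) l (𝓝 0) := by
  have hy0 := tendsto_iff_norm_sub_tendsto_zero.1 hy
  have hx0 := tendsto_iff_norm_sub_tendsto_zero.1 hx
  have hn0 := tendsto_iff_norm_sub_tendsto_zero.1 hn
  have hC := ht.const_add C
  have t1 := (hy0.mul ((hn.norm.mul hC).const_add 1)).mul hx.norm
  have t2 := (((hn0.mul hC).add (ht.const_mul ‖n₀‖)).const_mul ‖y₀‖).mul hx.norm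
  have t3 := hx0.const_mul (‖y₀‖ * (1 + ‖n₀‖ * C))
  simpa using (t1.add t2).add t3

end Limits

section Convergence

variable {E : Type*} [NormedAddCommGroup E] [NormedSpace ℂ E] [FiniteDimensional ℂ E] {a b : ℝ}

theorem isUnit_of_forall_eq_zero {M : E →L[ℂ] E} (h : ∀ c, M c = 0 → c = 0) : IsUnit M := by
  have : CompleteSpace E := FiniteDimensional.complete ℂ E
  have hinj : Function.Injective M := (injective_iff_map_eq_zero M).2 h
  exact ContinuousLinearMap.isUnit_iff_bijective.2
    ⟨hinj, LinearMap.injective_iff_surjective (f := M.toLinearMap).1 hinj⟩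

/-- The characteristic operator is invertible if the homogeneous problem has only the trivial
solution: an element `c` of its kernel gives the solution `Y c`. -/
theorem isUnit_characteristicOperator (hab : a ≤ b) {A : ℝ → E →L[ℂ] E}
    (hA : IntervalIntegrable A volume a b) {U : C(Icc a b, E) →L[ℂ] E}
    (hE : ∀ y : C(Icc a b, E),
      IsPrimitiveOn a b (IccExtend hab y) (fun s => A s (IccExtend hab y s)) → U y = 0 → y = 0) :
    IsUnit (characteristicOperator U (fundamental hab hA)) := by
  refine isUnit_of_forall_eq_zero fun c hc => ?_
  have h0 : IntervalIntegrable (fun s => IccExtend hab (⇑(Ring.inverse (fundamental hab hA))) s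
      ((0 : ℝ → E) s)) volume a b := by simp
  obtain ⟨h1, h2⟩ := isPrimitiveOn_variation hab hA h0 c rfl
  have hp : primitive hab h0 = 0 := by
    ext t
    simp
  rw [hp, add_zero] at h1 h2
  simp only [Pi.zero_apply, add_zero] at h1
  rw [hE _ h1 hc] at h2
  exact h2.symm

/-- If the fundamental solutions for `A i - A₀` tend to `1` uniformly and the boundary operators
converge in norm, then the Green kernels converge uniformly. The densities are chosen as
perturbations of the density for the limit problem, which makes the convergence uniform everywhere
and not only almost everywhere. -/
theorem exists_greenKernel_tendsto {ι : Type*} {l : Filter ι} (hab : a ≤ b)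
    {A R : ι → ℝ → E →L[ℂ] E} {A₀ : ℝ → E →L[ℂ] E}
    (hA : ∀ i, IntervalIntegrable (A i) volume a b) (hR : ∀ i, IntervalIntegrable (R i) volume a b)
    (hA₀ : IntervalIntegrable A₀ volume a b) (h : ∀ i s, A i s = R i s + A₀ s)
    (hlim : Tendsto (fun i => fundamental hab (hR i)) l (𝓝 1))
    {U : ι → C(Icc a b, E) →L[ℂ] E} {U₀ : C(Icc a b, E) →L[ℂ] E}
    (hU : Tendsto (fun i => ‖U i - U₀‖) l (𝓝 0))
    (hM : IsUnit (characteristicOperator U₀ (fundamental hab hA₀))) :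
    ∃ (G₀ : ℝ → ℝ → E →L[ℂ] E) (G : ι → ℝ → ℝ → E →L[ℂ] E) (β : ι → ℝ),
      IsGreenKernel hab A₀ U₀ G₀ ∧ (∀ᶠ i in l, IsGreenKernel hab (A i) (U i) (G i)) ∧
      Tendsto β l (𝓝 0) ∧ ∀ i t s, ‖G i t s - G₀ t s‖ ≤ β i := by
  have : CompleteSpace E := FiniteDimensional.complete ℂ E
  have hY := tendsto_fundamental hab hR hA₀ hA h hlim
  have hX := tendsto_ringInverse (𝔐 := C(Icc a b, E →L[ℂ] E)) (isUnit_fundamental hab hA₀) hY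
  set Y := fun i => fundamental hab (hA i) with hYdef
  set Y₀ := fundamental hab hA₀ with hY₀def
  set T := fun i => U i ∘L pointwiseAction E a b (Y i) with hT
  set T₀ := U₀ ∘L pointwiseAction E a b Y₀ with hT₀
  have hTlim : Tendsto T l (𝓝 T₀) :=
    tendsto_clm_comp (tendsto_norm_clm_sub_iff.1 hU)
      (((pointwiseAction E a b).continuous.tendsto _).comp hY)
  set M := fun i => characteristicOperator (U i) (Y i) with hMdef
  set M₀ := characteristicOperator U₀ Y₀ with hM₀def
  have hMlim : Tendsto M l (𝓝 M₀) := tendsto_clm_comp hTlim tendsto_const_nhds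
  have hN := tendsto_ringInverse (𝔐 := E →L[ℂ] E) hM hMlim
  have hMi : ∀ᶠ i in l, IsUnit (M i) := by
    obtain ⟨u, hu⟩ := hM
    exact hMlim.eventually (hu ▸ Units.nhds u)
  obtain ⟨h₀, hm₀, hb₀, hr₀⟩ := exists_density hab T₀
  choose k hmk hbk hrk using fun i => exists_density hab (T i - T₀)
  have hd₀ : IsDensity hab T₀ h₀ := ⟨hm₀, ⟨_, hb₀⟩, hr₀⟩
  have hd : ∀ i, IsDensity hab (T i) (fun s => h₀ s + k i s) := fun i => by
    have := hd₀.add ⟨hmk i, ⟨_, hbk i⟩, hrk i⟩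
    rwa [add_sub_cancel] at this
  have hτ : Tendsto (fun i => ‖T i - T₀‖) l (𝓝 0) :=
    tendsto_norm_clm_sub_iff.2 hTlim
  refine ⟨greenKernel hab Y₀ (Ring.inverse M₀) h₀,
    fun i => greenKernel hab (Y i) (Ring.inverse (M i)) (fun s => h₀ s + k i s), _,
    isGreenKernel_greenKernel hab hA₀ hd₀ hM,
    hMi.mono fun i hi => isGreenKernel_greenKernel hab (hA i) (hd i) hi, ?_,
    fun i t s => norm_greenKernel_sub_le hab (Y i) Y₀ _ _ hb₀
      (fun s => by rw [add_sub_cancel_left]; exact hbk i s) t s⟩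
  exact tendsto_error (B := C(Icc a b, E →L[ℂ] E)) hY hX hN hτ _

end Convergence

/-! ### Passage to matrices -/

section Matrices

variable {m : ℕ} {a b : ℝ}

/-- The operator on `ℂ^m` given by a matrix. -/
noncomputable def matOp (X : Matrix (Fin m) (Fin m) ℂ) : (Fin m → ℂ) →L[ℂ] (Fin m → ℂ) :=
  LinearMap.toContinuousLinearMap (Matrix.toLin' X)

@[simp]
theorem matOp_apply (X : Matrix (Fin m) (Fin m) ℂ) (v : Fin m → ℂ) : matOp X v = X *ᵥ v := rfl

/-- The matrix of an operator on `ℂ^m`. -/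
noncomputable def opMat (L : (Fin m → ℂ) →L[ℂ] (Fin m → ℂ)) : Matrix (Fin m) (Fin m) ℂ :=
  LinearMap.toMatrix' (L : (Fin m → ℂ) →ₗ[ℂ] (Fin m → ℂ))

theorem opMat_apply (L : (Fin m → ℂ) →L[ℂ] (Fin m → ℂ)) (i j : Fin m) :
    opMat L i j = L (Pi.single j 1) i := by
  simp [opMat, LinearMap.toMatrix'_apply]

@[simp]
theorem opMat_mulVec (L : (Fin m → ℂ) →L[ℂ] (Fin m → ℂ)) (v : Fin m → ℂ) : opMat L *ᵥ v = L v :=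
  LinearMap.toMatrix'_mulVec (L : (Fin m → ℂ) →ₗ[ℂ] (Fin m → ℂ)) v

theorem norm_apply_single_le (L : (Fin m → ℂ) →L[ℂ] (Fin m → ℂ)) (i j : Fin m) :
    ‖L (Pi.single j 1) i‖ ≤ ‖L‖ := by
  have h1 : ‖(Pi.single j 1 : Fin m → ℂ)‖ ≤ 1 := by
    refine (pi_norm_le_iff_of_nonneg zero_le_one).2 fun k => ?_
    by_cases hk : k = j
    · subst hk
      simp
    · simp [hk]
  exact (norm_le_pi_norm _ i).trans (L.unit_le_opNorm _ h1)

theorem matNorm_opMat_sub_le (L L' : (Fin m → ℂ) →L[ℂ] (Fin m → ℂ)) :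
    matNorm (opMat L - opMat L') ≤ m * m * ‖L - L'‖ := by
  have h : ∀ i j, ‖(opMat L - opMat L') i j‖ ≤ ‖L - L'‖ := fun i j => by
    rw [Matrix.sub_apply, opMat_apply, opMat_apply]
    exact norm_apply_single_le (L - L') i j
  calc _ ≤ ∑ _i : Fin m, ∑ _j : Fin m, ‖L - L'‖ :=
        Finset.sum_le_sum fun i _ => Finset.sum_le_sum fun j _ => h i j
    _ = _ := by simp [mul_assoc]

theorem matNorm_nonneg (X : Matrix (Fin m) (Fin m) ℂ) : 0 ≤ matNorm X :=
  Finset.sum_nonneg fun _ _ => Finset.sum_nonneg fun _ _ => norm_nonneg _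

theorem norm_matOp_le (X : Matrix (Fin m) (Fin m) ℂ) : ‖matOp X‖ ≤ matNorm X := by
  have h0 := matNorm_nonneg X
  refine ContinuousLinearMap.opNorm_le_bound _ h0 fun v =>
    (pi_norm_le_iff_of_nonneg (by positivity)).2 fun i => ?_
  calc ‖matOp X v i‖ = ‖∑ j, X i j * v j‖ := rfl
    _ ≤ ∑ j, ‖X i j‖ * ‖v‖ := by
        refine (norm_sum_le _ _).trans (Finset.sum_le_sum fun j _ => ?_)
        rw [norm_mul]
        gcongr
        exact norm_le_pi_norm v j
    _ = (∑ j, ‖X i j‖) * ‖v‖ := by rw [Finset.sum_mul]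
    _ ≤ _ := by
        gcongr
        exact Finset.single_le_sum (f := fun i => ∑ j, ‖X i j‖)
          (fun i _ => Finset.sum_nonneg fun j _ => norm_nonneg _) (Finset.mem_univ i)

/-- The operator with the `j`-th column `v` and the other columns zero. -/
noncomputable def columnOp (j : Fin m) :
    (Fin m → ℂ) →L[ℂ] (Fin m → ℂ) →L[ℂ] (Fin m → ℂ) :=
  ContinuousLinearMap.smulRightL ℂ (Fin m → ℂ) (Fin m → ℂ) (ContinuousLinearMap.proj j)

theorem matOp_eq_sum_columnOp (X : Matrix (Fin m) (Fin m) ℂ) :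
    matOp X = ∑ j, columnOp j (fun i => X i j) := by
  ext v i
  simp [columnOp, Matrix.mulVec, dotProduct, Finset.sum_apply, mul_comm]

theorem intervalIntegrable_matOp (hab : a ≤ b) {R : ℝ → Matrix (Fin m) (Fin m) ℂ}
    (hR : MatIntegrable a b R) : IntervalIntegrable (fun t => matOp (R t)) volume a b := by
  have hcol : ∀ j, IntervalIntegrable (fun t i => R t i j) volume a b := fun j => by
    rw [intervalIntegrable_iff_integrableOn_Icc_of_le hab]
    exact Integrable.of_eval fun i => hR i j
  have := IntervalIntegrable.sum Finset.univ fun j _ => intervalIntegrable_clm (columnOp j) (hcol j)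
  refine this.congr fun t _ => ?_
  rw [matOp_eq_sum_columnOp, Finset.sum_apply]

theorem IsPrimitiveOn.clm_comp {F G : Type*} [NormedAddCommGroup F] [NormedSpace ℂ F]
    [CompleteSpace F] [NormedAddCommGroup G] [NormedSpace ℂ G] [CompleteSpace G]
    (L : F →L[ℂ] G) {y g : ℝ → F} (h : IsPrimitiveOn a b y g) :
    IsPrimitiveOn a b (fun t => L (y t)) (fun t => L (g t)) := by
  refine ⟨intervalIntegrable_clm L h.1, fun t ht => ?_⟩
  rw [h.2 t ht, map_add, L.intervalIntegral_comp_comm (intervalIntegrable_of_mem_Icc h.1 ⟨t, ht⟩)]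

theorem IsPrimitiveOn.sum {F ι : Type*} [NormedAddCommGroup F] [NormedSpace ℝ F] {s : Finset ι}
    {y g : ι → ℝ → F} (h : ∀ i ∈ s, IsPrimitiveOn a b (y i) (g i)) :
    IsPrimitiveOn a b (fun t => ∑ i ∈ s, y i t) (fun t => ∑ i ∈ s, g i t) := by
  refine ⟨?_, fun t ht => ?_⟩
  · have := IntervalIntegrable.sum s fun i hi => (h i hi).1
    refine this.congr fun t _ => ?_
    rw [Finset.sum_apply]
  · rw [intervalIntegral.integral_finsetSum fun i hi =>
      intervalIntegrable_of_mem_Icc (h i hi).1 ⟨t, ht⟩, ← Finset.sum_add_distrib]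
    exact Finset.sum_congr rfl fun i hi => (h i hi).2 t ht

/-- Absolutely continuous solutions of a system are the solutions of the integral equation. -/
theorem solvesSystem_iff (hab : a ≤ b) {A : ℝ → Matrix (Fin m) (Fin m) ℂ}
    (hA : MatIntegrable a b A) {f : ℝ → Fin m → ℂ} (hf : IntervalIntegrable f volume a b)
    (y : C(Icc a b, Fin m → ℂ)) :
    SolvesSystem a b A f (IccExtend hab y) ↔
      IsPrimitiveOn a b (IccExtend hab y) (fun s => matOp (A s) (IccExtend hab y s) + f s) :=
  ⟨fun h => isPrimitiveOn_of_ae_hasDerivAt hab h.1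
    ((intervalIntegrable_clm_apply hab (intervalIntegrable_matOp hab hA) y).add hf) h.2,
    fun h => ⟨h.absolutelyContinuousOnInterval hab, h.ae_hasDerivAt⟩⟩

/-- The matrix solution of the Cauchy problem is the fundamental solution. -/
theorem SolvesMatrixCauchy.eq_fundamental (hab : a ≤ b) {R Z : ℝ → Matrix (Fin m) (Fin m) ℂ}
    (hR : MatIntegrable a b R) (hZ : SolvesMatrixCauchy a b R Z) (t : Icc a b) :
    fundamental hab (intervalIntegrable_matOp hab hR) t = matOp (Z t) := by
  have hcol : ∀ j, IsPrimitiveOn a b (fun t i => Z t i j)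
      (fun t => R t *ᵥ fun i => Z t i j) := fun j => by
    obtain ⟨hac, hd⟩ := hZ.2 j
    have hc := hac.continuousOn
    rw [uIcc_of_le hab] at hc
    have hi := intervalIntegrable_clm_apply hab (intervalIntegrable_matOp hab hR)
      ⟨_, hc.domRestrict⟩
    refine isPrimitiveOn_of_ae_hasDerivAt hab hac (hi.congr fun s hs => ?_) (by simpa using hd)
    rw [uIoc_of_le hab] at hs
    rw [IccExtend_of_mem hab _ (Ioc_subset_Icc_self hs)]
    rfl
  have hp := IsPrimitiveOn.sum (s := Finset.univ) fun j _ => (hcol j).clm_comp (columnOp j)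
  simp only [← matOp_eq_sum_columnOp] at hp
  have hcont := hp.continuousOn hab
  set W : C(Icc a b, (Fin m → ℂ) →L[ℂ] (Fin m → ℂ)) := ⟨_, hcont.domRestrict⟩ with hW
  have hWt : ∀ t (ht : t ∈ Icc a b), IccExtend hab W t = matOp (Z t) := fun t ht => by
    rw [IccExtend_of_mem hab _ ht]
    rfl
  have hWe : W = fundamental hab (intervalIntegrable_matOp hab hR) := by
    refine GreenBVP.eq_fundamental hab _
      (hp.congr hab (fun t ht => (hWt t ht).symm) fun t ht => ?_) ?_
    · rw [hWt t ht]
      ext v i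
      have e := (matOp_eq_sum_columnOp (R t * Z t)).symm
      have e' : ∀ j, (fun i => (R t * Z t) i j) = R t *ᵥ fun i => Z t i j := fun j => rfl
      simp only [e'] at e
      rw [e]
      simp [Matrix.mulVec_mulVec]
    · rw [hWt a (left_mem_Icc.2 hab), hZ.1]
      ext v i
      simp
  rw [← hWe]
  rfl

theorem isGreenMatrix_of_isGreenKernel (hab : a ≤ b) {A : ℝ → Matrix (Fin m) (Fin m) ℂ}
    (hA : MatIntegrable a b A) {U : C(Icc a b, Fin m → ℂ) →L[ℂ] (Fin m → ℂ)}
    {G : ℝ → ℝ → (Fin m → ℂ) →L[ℂ] (Fin m → ℂ)}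
    (hG : IsGreenKernel hab (fun t => matOp (A t)) U G) :
    IsGreenMatrix hab A U (fun t s => opMat (G t s)) := by
  obtain ⟨C, hC⟩ := hG.exists_bound
  refine ⟨fun i j => ?_, fun f hf => ?_⟩
  · refine MemLp.mono_measure Measure.restrict_le_self (memLp_top_of_bound (C := C) ?_
      (.of_forall fun p => ?_))
    · have := ((ContinuousLinearMap.proj (R := ℂ) (φ := fun _ : Fin m => ℂ) i) ∘L
        ContinuousLinearMap.apply ℂ (Fin m → ℂ)
          (Pi.single j 1)).continuous.comp_aestronglyMeasurable hG.1
      refine this.congr (.of_forall fun p => ?_)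
      simp [opMat_apply]
    · rw [opMat_apply]
      exact (norm_apply_single_le _ i j).trans (hC p.1 p.2)
  · have hf' := (intervalIntegrable_iff_integrableOn_Icc_of_le hab).2 hf
    obtain ⟨y, ⟨h1, h2⟩, h3, h4⟩ := hG.representation f hf'
    refine ⟨y, ⟨(solvesSystem_iff hab hA hf' y).2 h1, h2⟩,
      fun z hz => h3 z ⟨(solvesSystem_iff hab hA hf' z).1 hz.1, hz.2⟩, fun t => ?_⟩
    simp only [opMat_mulVec]
    rw [← intervalIntegrable_iff_integrableOn_Icc_of_le hab]
    exact h4 t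

/-- The Green matrix is determined almost everywhere on the square: testing with
`f = 1_S e_j` determines `G(t, ·)` almost everywhere for every `t`. -/
theorem IsGreenMatrix.ae_eq (hab : a ≤ b) {A : ℝ → Matrix (Fin m) (Fin m) ℂ}
    {U : C(Icc a b, Fin m → ℂ) →L[ℂ] (Fin m → ℂ)} {G G' : ℝ → ℝ → Matrix (Fin m) (Fin m) ℂ}
    (hG : IsGreenMatrix hab A U G) (hG' : IsGreenMatrix hab A U G') :
    ∀ᵐ p : ℝ × ℝ ∂(volume.restrict (Icc a b ×ˢ Icc a b)), G p.1 p.2 = G' p.1 p.2 := by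
  have hsec : ∀ t ∈ Icc a b, ∀ j, ∀ᵐ s ∂(volume.restrict (Icc a b)),
      (G t s - G' t s) *ᵥ Pi.single j 1 = 0 := by
    intro t ht j
    have hconst : IntegrableOn (fun _ : ℝ => (Pi.single j 1 : Fin m → ℂ)) (Icc a b) :=
      integrableOn_const (by simp)
    obtain ⟨y, -, -, hy⟩ := hG.representation _ hconst
    obtain ⟨y', -, -, hy'⟩ := hG'.representation _ hconst
    have hI : Integrable (fun s => (G t s - G' t s) *ᵥ Pi.single j 1)
        (volume.restrict (Icc a b)) := by
      simp only [Matrix.sub_mulVec]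
      exact (hy ⟨t, ht⟩).1.sub (hy' ⟨t, ht⟩).1
    refine hI.ae_eq_zero_of_forall_setIntegral_eq_zero fun S hS _ => ?_
    have hSi := hconst.indicator hS
    obtain ⟨z, hz, -, hzr⟩ := hG.representation _ hSi
    obtain ⟨z', -, hu, hzr'⟩ := hG'.representation _ hSi
    obtain ⟨i1, e1⟩ := hzr ⟨t, ht⟩
    obtain ⟨i2, e2⟩ := hzr' ⟨t, ht⟩
    rw [← hu z hz, e1, ← sub_eq_zero, intervalIntegral.integral_of_le hab,
      intervalIntegral.integral_of_le hab, ← integral_Icc_eq_integral_Ioc,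
      ← integral_Icc_eq_integral_Ioc, ← integral_sub i1 i2] at e2
    rw [← integral_indicator hS, ← e2]
    refine integral_congr_ae (.of_forall fun s => ?_)
    by_cases hs : s ∈ S
    · simp only [indicator_of_mem hs, Matrix.sub_mulVec]
    · simp [hs]
  have hent : ∀ i j, ∀ᵐ p : ℝ × ℝ ∂(volume.restrict (Icc a b ×ˢ Icc a b)),
      G p.1 p.2 i j - G' p.1 p.2 i j = 0 := by
    intro i j
    have hm : AEMeasurable (fun p : ℝ × ℝ => ‖G p.1 p.2 i j - G' p.1 p.2 i j‖ₑ)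
        (volume.restrict (Icc a b ×ˢ Icc a b)) :=
      ((hG.memLp_top i j).1.sub (hG'.memLp_top i j).1).enorm
    have h0 : ∫⁻ p : ℝ × ℝ in Icc a b ×ˢ Icc a b, ‖G p.1 p.2 i j - G' p.1 p.2 i j‖ₑ = 0 := by
      rw [Measure.volume_eq_prod, ← Measure.prod_restrict] at hm ⊢
      rw [lintegral_prod _ hm]
      refine (lintegral_congr_ae (g := fun _ => 0) ?_).trans lintegral_zero
      filter_upwards [ae_restrict_mem measurableSet_Icc] with t ht
      refine (lintegral_congr_ae (g := fun _ => 0) ?_).trans lintegral_zero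
      filter_upwards [hsec t ht j] with s hs
      have := congrFun hs i
      rw [Matrix.mulVec_single_one] at this
      simpa using this
    filter_upwards [(lintegral_eq_zero_iff' hm).1 h0] with p hp
    simpa using hp
  have hall := ae_all_iff.2 fun i => ae_all_iff.2 (hent i)
  filter_upwards [hall] with p hp
  ext i j
  exact sub_eq_zero.1 (hp i j)

end Matrices

/-! ### Green matrices depending on a parameter -/

theorem tendsto_fundamental_of_classM {m : ℕ} {a b ε₀ : ℝ} (hab : a ≤ b)
    {R : ℝ → ℝ → Matrix (Fin m) (Fin m) ℂ} (hM : ClassM a b ε₀ R) {p : ℝ → ℝ}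
    (hp : ∀ ε, p ε ∈ Icc 0 ε₀) (hp' : ∀ᶠ ε in 𝓝[>] (0 : ℝ), p ε = ε) :
    Tendsto (fun ε => fundamental hab (intervalIntegrable_matOp hab (hM.1 (p ε) (hp ε))))
      (𝓝[>] (0 : ℝ)) (𝓝 1) := by
  obtain ⟨hR, Z, hZ, hlim⟩ := hM
  refine (Metric.tendsto_nhds (α := C(Icc a b, (Fin m → ℂ) →L[ℂ] Fin m → ℂ))).2 fun δ hδ => ?_
  filter_upwards [hlim (δ / 2) (half_pos hδ), hp'] with ε h1 h2
  refine lt_of_le_of_lt ((ContinuousMap.dist_le (half_pos hδ).le).2 fun t => ?_) (half_lt_self hδ)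
  rw [dist_eq_norm, (hZ (p ε) (hp ε)).eq_fundamental hab (hR (p ε) (hp ε)) t,
    ContinuousMap.one_apply, h2]
  have e : matOp (Z ε t) - 1 = matOp (Z ε t - 1) := by
    ext v i
    simp [Matrix.sub_mulVec]
  rw [e]
  exact (norm_matOp_le _).trans (h1 t t.2).le

/-- Green matrices of the problems with small parameter that converge uniformly with an explicit
error bound. -/
theorem exists_greenMatrix_tendsto {m : ℕ} {a b ε₀ : ℝ} (hab : a < b) (hε₀ : 0 < ε₀)
    {A : ℝ → ℝ → Matrix (Fin m) (Fin m) ℂ} (hA : ∀ ε ∈ Icc 0 ε₀, MatIntegrable a b (A ε))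
    {U : ℝ → C(Icc a b, Fin m → ℂ) →L[ℂ] (Fin m → ℂ)}
    (hE : ∀ y : C(Icc a b, Fin m → ℂ), SolvesBVP hab.le (A 0) 0 (U 0) 0 y → y = 0)
    (hM : ClassM a b ε₀ (fun ε t => A ε t - A 0 t))
    (hU : Tendsto (fun ε => ‖U ε - U 0‖) (𝓝[>] (0 : ℝ)) (𝓝 0)) :
    ∃ ε₁ : ℝ, 0 < ε₁ ∧ ε₁ ≤ ε₀ ∧ ∃ (G : ℝ → ℝ → ℝ → Matrix (Fin m) (Fin m) ℂ) (β : ℝ → ℝ),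
      (∀ ε ∈ Icc 0 ε₁, IsGreenMatrix hab.le (A ε) (U ε) (G ε)) ∧
      Tendsto β (𝓝[>] (0 : ℝ)) (𝓝 0) ∧
      ∀ᶠ ε in 𝓝[>] (0 : ℝ), ∀ t s, matNorm (G ε t s - G 0 t s) ≤ β ε := by
  -- The parameter is clamped to `[0, ε₀]`, so that all coefficients are integrable.
  set p : ℝ → ℝ := fun ε => projIcc 0 ε₀ hε₀.le ε with hpdef
  have hp : ∀ ε, p ε ∈ Icc 0 ε₀ := fun ε => (projIcc 0 ε₀ hε₀.le ε).2
  have hpe : ∀ ε ∈ Icc 0 ε₀, p ε = ε := fun ε hε => by rw [hpdef]; simp [projIcc_of_mem _ hε]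
  have hp' : ∀ᶠ ε in 𝓝[>] (0 : ℝ), p ε = ε := by
    filter_upwards [Ioc_mem_nhdsGT hε₀] with ε hε using hpe ε (Ioc_subset_Icc_self hε)
  have h0 : (0 : ℝ) ∈ Icc 0 ε₀ := left_mem_Icc.2 hε₀.le
  have hA₀ := intervalIntegrable_matOp hab.le (hA 0 h0)
  have hchar := isUnit_characteristicOperator hab.le hA₀ (U := U 0) fun y hy hy0 =>
    hE y ⟨(solvesSystem_iff hab.le (hA 0 h0) IntervalIntegrable.zero y).2 (by simpa using hy), hy0⟩
  obtain ⟨G₀, G, β, hG₀, hG, hβ, hb⟩ := exists_greenKernel_tendsto hab.le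
    (fun ε => intervalIntegrable_matOp hab.le (hA (p ε) (hp ε)))
    (fun ε => intervalIntegrable_matOp hab.le (hM.1 (p ε) (hp ε))) hA₀
    (fun ε s => by
      ext v i
      simp [Matrix.sub_mulVec])
    (tendsto_fundamental_of_classM hab.le hM hp hp')
    hU hchar
  obtain ⟨δ, hδ, hδG⟩ := mem_nhdsGT_iff_exists_Ioc_subset.1 hG
  refine ⟨min δ ε₀, lt_min hδ hε₀, min_le_right _ _,
    fun ε t s => opMat (if ε = 0 then G₀ t s else G ε t s), fun ε => m * m * β ε,
    fun ε hε => ?_, by simpa using hβ.const_mul ((m : ℝ) * m), ?_⟩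
  · rcases hε.1.eq_or_lt with rfl | hpos
    · simpa using isGreenMatrix_of_isGreenKernel hab.le (hA 0 h0) hG₀
    · have hεm : ε ∈ Icc 0 ε₀ := ⟨hε.1, hε.2.trans (min_le_right _ _)⟩
      have hGε : IsGreenKernel hab.le (fun t => matOp (A (p ε) t)) (U ε) (G ε) :=
        hδG ⟨hpos, hε.2.trans (min_le_left _ _)⟩
      rw [hpe ε hεm] at hGε
      simpa [hpos.ne'] using isGreenMatrix_of_isGreenKernel hab.le (hA ε hεm) hGε
  · filter_upwards [self_mem_nhdsWithin] with ε hε t s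
    rw [if_neg (ne_of_gt hε), if_pos rfl]
    refine (matNorm_opMat_sub_le _ _).trans ?_
    gcongr
    exact hb ε t s

end GreenBVP

theorem mainTheorem2 (m : ℕ) (a b ε₀ : ℝ) (hab : a < b) (hε₀ : 0 < ε₀)
    (A : ℝ → ℝ → Matrix (Fin m) (Fin m) ℂ)
    (hA : ∀ ε ∈ Icc 0 ε₀, GreenBVP.MatIntegrable a b (A ε))
    (U : ℝ → C(Icc a b, Fin m → ℂ) →L[ℂ] (Fin m → ℂ))
    (hE : ∀ y : C(Icc a b, Fin m → ℂ), GreenBVP.SolvesBVP hab.le (A 0) 0 (U 0) 0 y → y = 0)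
    (hM : GreenBVP.ClassM a b ε₀ (fun ε t => A ε t - A 0 t))
    (hU : Tendsto (fun ε => ‖U ε - U 0‖) (𝓝[>] (0 : ℝ)) (𝓝 0)) :
    (∃ ε₁ : ℝ, 0 < ε₁ ∧ ε₁ ≤ ε₀ ∧
      ∃ G : ℝ → ℝ → ℝ → Matrix (Fin m) (Fin m) ℂ,
        (∀ ε ∈ Icc 0 ε₁, GreenBVP.IsGreenMatrix hab.le (A ε) (U ε) (G ε)) ∧
        ∀ δ : ℝ, 0 < δ → ∀ᶠ ε in 𝓝[>] (0 : ℝ), ∀ t ∈ Icc a b, ∀ s ∈ Icc a b,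
          GreenBVP.matNorm (G ε t s - G 0 t s) < δ) ∧
    (∀ G : ℝ → ℝ → ℝ → Matrix (Fin m) (Fin m) ℂ,
      GreenBVP.IsGreenMatrix hab.le (A 0) (U 0) (G 0) →
      (∀ᶠ ε in 𝓝[>] (0 : ℝ), GreenBVP.IsGreenMatrix hab.le (A ε) (U ε) (G ε)) →
      Tendsto (fun ε => eLpNorm
          (fun p : ℝ × ℝ => GreenBVP.matNorm (G ε p.1 p.2 - G 0 p.1 p.2)) ∞
          (volume.restrict (Icc a b ×ˢ Icc a b)))
        (𝓝[>] (0 : ℝ)) (𝓝 0)) := by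
  obtain ⟨ε₁, hε₁, hle, G, β, hG, hβ, hb⟩ :=
    GreenBVP.exists_greenMatrix_tendsto hab hε₀ hA hE hM hU
  refine ⟨⟨ε₁, hε₁, hle, G, hG, fun δ hδ => ?_⟩, fun G' hG'₀ hG' => ?_⟩
  · filter_upwards [hb, hβ.eventually_lt_const hδ] with ε h1 h2 t _ s _
    exact (h1 t s).trans_lt h2
  · have hlim : Tendsto (fun ε => ENNReal.ofReal (β ε)) (𝓝[>] (0 : ℝ)) (𝓝 0) := by
      simpa using ENNReal.tendsto_ofReal hβ
    refine tendsto_of_tendsto_of_tendsto_of_le_of_le' tendsto_const_nhds hlim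
      (.of_forall fun _ => zero_le) ?_
    filter_upwards [hb, hG', Ioc_mem_nhdsGT hε₁] with ε h1 h2 h3
    rw [eLpNorm_exponent_top]
    refine eLpNormEssSup_le_of_ae_bound ?_
    filter_upwards [h2.ae_eq hab.le (hG ε (Ioc_subset_Icc_self h3)),
      hG'₀.ae_eq hab.le (hG 0 (left_mem_Icc.2 hε₁.le))] with p e1 e2
    rw [e1, e2, Real.norm_of_nonneg (GreenBVP.matNorm_nonneg _)]
    exact h1 p.1 p.2
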